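/- Throughout, a complex Hilbert manifold is a Hausdorff, second countable complex manifold modelled on the Hilbert space $\ell^2$ of square summable sequences of complex numbers (with holomorphic transition maps). Let $q$ be a natural number, $\Delta^q(r)=\{z\in\mathbb{C}^q: |z_i|<r \text{ for all } i\}$, $\Delta^q=\Delta^q(1)$, $\Delta(r)=\Delta^1(r)$, $\Delta=\Delta(1)$, and for $0<r<1$ let $$H_q^1(r)=\big(\Delta^q\times\Delta(r)\big)\cup\big((\Delta^q\setminus\overline{\Delta}{}^q(1-r))\times\Delta\big)\subset\mathbb{C}^{q+1}$$ be the $q$-concave Hartogs figure, where $\overline{\Delta}{}^q(s)=\{z\in\mathbb{C}^q: |z_i|\le s \text{ for all } i\}$. A complex Hilbert manifold $\mathcal{Y}$ is called $q$-Hartogs if for every $r\in(0,1)$ every holomorphic map $H_q^1(r)\to\mathcal{Y}$ extends to a holomorphic map $\Delta^{q+1}\to\mathcal{Y}$. Let $\mathcal{D}$ be a domain (a nonempty connected open set) in a complex Hilbert manifold $\mathcal{X}$ and let $p\in\partial\mathcal{D}$. Suppose that $\mathcal{D}$ has $\mathcal{C}^2$ boundary near $p$ and is $q$-pseudoconcave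 at $p$: there are an open neighbourhood $\mathcal{U}$ of $p$ and a real function $\rho$ of class $\mathcal{C}^2$ on $\mathcal{U}$ with $\mathcal{D}\cap\mathcal{U}=\{x\in\mathcal{U}:\rho(x)<0\}$ and $d\rho\neq0$ at every point of $\partial\mathcal{D}\cap\mathcal{U}$, such that the complex Hessian (Levi form) $v\mapsto\sum_{k,l}\frac{\partial^2\rho}{\partial z_k\partial\bar z_l}(p)\,v_k\bar v_l$ of $\rho$ at $p$ (in local coordinates), restricted to the complex tangent space $T^c_p\partial\mathcal{D}=\{v: d\rho_p(v)=d\rho_p(iv)=0\}$, has at least $q$ negative eigenvalues, in the sense that it is negative definite on some complex subspace of $T^c_p\partial\mathcal{D}$ of dimension $q$. Then every holomorphic map $f:\mathcal{D}\to\mathcal{Y}$ into a $q$-Hartogs Hilbert manifold $\mathcal{Y}$ extends holomorphically to a neighbourhood of $p$: there are an open neighbourhood $\mathcal{V}$ of $p$ in $\mathcal{X}$ and a holomorphic map $g:\mathcal{D}\cup\mathcal{V}\to\mathcal{Y}$ with $g=f$ on $\mathcal{D}$. -/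

import Mathlib

open Set
open scoped Manifold ContDiff

noncomputable section

namespace HartogsHilbert

/-- The Hilbert space of square summable sequences of complex numbers. -/
abbrev EllTwo : Type := lp (fun _ : ℕ => ℂ) 2

/-! ### Hartogs figures and Hartogs manifolds -/

/-- The open polydisc of radius `r` in `ℂ^q`, centred at the origin. -/
def polydisc (q : ℕ) (r : ℝ) : Set (Fin q → ℂ) := {z | ∀ i, ‖z i‖ < r}

/-- The closed polydisc of radius `r` in `ℂ^q`, centred at the origin. -/
def closedPolydisc (q : ℕ) (r : ℝ) : Set (Fin q → ℂ) := {z | ∀ i, ‖z i‖ ≤ r}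

/-- The ring domain `A^q_{r₁,r₂}`, an open polydisc minus a smaller closed one. -/
def ringDomain (q : ℕ) (r₁ r₂ : ℝ) : Set (Fin q → ℂ) :=
  polydisc q r₂ \ closedPolydisc q r₁

/-- The `q`-concave Hartogs figure `(Δ^q × Δ(r)) ∪ (A^q_{1-r,1} × Δ)` in `ℂ^{q+1} = ℂ^q × ℂ`. -/
def hartogsFigure (q : ℕ) (r : ℝ) : Set ((Fin q → ℂ) × ℂ) :=
  (polydisc q 1 ×ˢ Metric.ball (0 : ℂ) r) ∪ (ringDomain q (1 - r) 1 ×ˢ Metric.ball (0 : ℂ) 1)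

/-- The unit polydisc in `ℂ^{q+1} = ℂ^q × ℂ`. -/
def unitPolydisc (q : ℕ) : Set ((Fin q → ℂ) × ℂ) :=
  polydisc q 1 ×ˢ Metric.ball (0 : ℂ) 1

section

variable {E : Type*} [NormedAddCommGroup E] [NormedSpace ℂ E]

/-- A complex manifold `Y` modelled on `E` is `q`-Hartogs if every holomorphic map from a
`q`-concave Hartogs figure to `Y` extends to a holomorphic map from the unit polydisc to `Y`. -/
def IsHartogs (E : Type*) [NormedAddCommGroup E] [NormedSpace ℂ E] (q : ℕ)
    (Y : Type*) [TopologicalSpace Y] [ChartedSpace E Y] : Prop :=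
  ∀ r : ℝ, 0 < r → r < 1 → ∀ f : (Fin q → ℂ) × ℂ → Y,
    MDifferentiableOn 𝓘(ℂ, (Fin q → ℂ) × ℂ) 𝓘(ℂ, E) f (hartogsFigure q r) →
    ∃ g : (Fin q → ℂ) × ℂ → Y,
      MDifferentiableOn 𝓘(ℂ, (Fin q → ℂ) × ℂ) 𝓘(ℂ, E) g (unitPolydisc q) ∧
      EqOn g f (hartogsFigure q r)

/-! ### The complex Hessian and pseudoconcavity -/

/-- The value `∑ ∂²u/∂z_k∂z̄_l (a) v_k v̄_l` at `v` of the complex Hessian of `u` at `a`, written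
without coordinates as `(D²u(a)(v, v) + D²u(a)(iv, iv)) / 4`, where `D²u` is the second
real derivative. -/
def complexHessian (u : E → ℝ) (a v : E) : ℝ :=
  (fderiv ℝ (fderiv ℝ u) a v v
    + fderiv ℝ (fderiv ℝ u) a (Complex.I • v) (Complex.I • v)) / 4

/-- The largest complex subspace of the kernel of the real derivative `du(a)`, that is, the complex
tangent space at `a` of the level set of `u` through `a`. -/
def complexTangentSpace (u : E → ℝ) (a : E) : Submodule ℂ E where
  carrier := {v | fderiv ℝ u a v = 0 ∧ fderiv ℝ u a (Complex.I • v) = 0}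
  add_mem' := by
    rintro v w ⟨h1, h2⟩ ⟨h3, h4⟩
    simp [h1, h2, h3, h4]
  zero_mem' := by simp
  smul_mem' := by
    rintro c v ⟨h1, h2⟩
    have e1 : c • v = c.re • v + c.im • (Complex.I • v) := by
      rw [← Complex.coe_smul c.re, ← Complex.coe_smul c.im, smul_smul, ← add_smul,
        Complex.re_add_im]
    have e2 : Complex.I • c • v = c.re • (Complex.I • v) - c.im • v := by
      rw [← Complex.coe_smul c.re, ← Complex.coe_smul c.im, smul_smul, smul_smul, ← sub_smul]
      congr 1
      apply Complex.ext <;> simp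
    constructor
    · rw [e1, map_add, map_smul, map_smul, h1, h2]; simp
    · rw [e2, map_sub, (fderiv ℝ u a).map_smul, (fderiv ℝ u a).map_smul, h1, h2]; simp

/-- `ρ` is a `C²` defining function of `D` on the open neighbourhood `U` of `p`. -/
structure IsLocalDefiningFunction (E : Type*) [NormedAddCommGroup E] [NormedSpace ℂ E]
    {X : Type*} [TopologicalSpace X] [ChartedSpace E X]
    (D U : Set X) (ρ : X → ℝ) (p : X) : Prop where
  isOpen : IsOpen U
  mem : p ∈ U
  contMDiffOn : ContMDiffOn 𝓘(ℝ, E) 𝓘(ℝ, ℝ) 2 ρ U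
  inter_eq : D ∩ U = {x ∈ U | ρ x < 0}
  mfderiv_ne_zero : ∀ x ∈ frontier D ∩ U, mfderiv 𝓘(ℝ, E) 𝓘(ℝ, ℝ) ρ x ≠ 0

/-- `D` has a `C²` boundary near its boundary point `p` and is `q`-pseudoconcave there: the complex
Hessian at `p` of a local defining function, read in the chart at `p` and restricted to the
complex tangent space of the boundary, has at least `q` negative eigenvalues. As a tangent space
carries no preferred inner product, this is expressed invariantly: the form is
negative definite on a complex subspace of dimension `q`. -/
def IsPseudoconcaveAt (E : Type*) [NormedAddCommGroup E] [NormedSpace ℂ E]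
    {X : Type*} [TopologicalSpace X] [ChartedSpace E X] (q : ℕ) (D : Set X) (p : X) : Prop :=
  p ∈ frontier D ∧ ∃ (U : Set X) (ρ : X → ℝ), IsLocalDefiningFunction E D U ρ p ∧
    ∃ W : Submodule ℂ E, Module.finrank ℂ W = q ∧
      W ≤ complexTangentSpace (ρ ∘ (chartAt E p).symm) (chartAt E p p) ∧
      ∀ v ∈ W, v ≠ 0 → complexHessian (ρ ∘ (chartAt E p).symm) (chartAt E p p) v < 0

end

end HartogsHilbert

end

/-!
The complex tangent space contains a `q`-dimensional subspace on which the Levi form of the defining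
function `u` is negative, so near `p` and after a quadratic change of the normal coordinate, the domain
contains (up to errors negligible in the scaling `(ε, ε²)`) the paraboloid `{re w < c ‖z‖²}` in
`q + 1` complex variables (`exists_isAdapted`). Arbitrarily small `q`-concave Hartogs figures fit into
the paraboloid while their polydiscs contain the boundary point. The Hartogs property of `Y`, applied
to a single such figure, gives the extension along one `(q + 1)`-dimensional slice through `p`, and in
particular a limit value `y₀` of `f` along this slice (`IsAdapted.exists_continuousAt_extension`).

It remains to extend in the infinitely many transverse directions, for which the Hartogs property of
`Y` says nothing. Here the extension along the slice serves to localize the target. On the part of the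
slice near `p` that lies in the domain, `f` takes values in a chart ball around `y₀`. For a small disc
through `p` tangent to the boundary, this applies to its boundary circle, to the translates of the
circle along a short inner normal segment, and to the whole disc once it is pushed inside. By
compactness the same holds for all small translates in the ambient Banach space. The mean of `f`, read
in the chart, over the circle centred at `x` is therefore a holomorphic function of `x` near `p`
(`DifferentiableOn.circleAverage_comp_add`). It equals `f` near the inner end of the segment by the
mean value property, and at the other points of the domain near `p` by the identity theorem of one
variable, along segments that descend inside the domain in the normal direction
(`IsAdapted.exists_local_extension`).

For `q = 0` there is no tangential disc, but then no nonempty `Y` of positive dimension is `q`-Hartogs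
(`not_isHartogs_zero`).
-/

/-! ### Holomorphic maps between Banach spaces -/

section HolomorphicMaps

variable {E F : Type*} [NormedAddCommGroup E] [NormedSpace ℂ E]
  [NormedAddCommGroup F] [NormedSpace ℂ F]

theorem norm_fderiv_le_of_norm_le {h : E → F} {x : E} {r C : ℝ} (hr : 0 < r)
    (hd : DifferentiableOn ℂ h (Metric.ball x r)) (hC : ∀ y ∈ Metric.ball x r, ‖h y‖ ≤ C) :
    ‖fderiv ℂ h x‖ ≤ 2 * C / r := by
  refine Complex.norm_fderiv_le_div_of_mapsTo_ball (R₂ := 2 * C) hd ?_ hr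
  intro y hy
  rw [Metric.mem_closedBall, dist_eq_norm]
  have h1 := hC y hy
  have h2 := hC x (Metric.mem_ball_self hr)
  have h3 := norm_sub_le (h y) (h x)
  linarith

/-- The derivative of a holomorphic map is continuous: the Cauchy estimate bounds it locally, so the
map is locally Lipschitz, and the Cauchy estimate for the differences `h (· + d) - h` concludes. -/
theorem DifferentiableOn.continuousOn_fderiv_of_isOpen {h : E → F} {N : Set E} (hN : IsOpen N)
    (hh : DifferentiableOn ℂ h N) : ContinuousOn (fderiv ℂ h) N := by
  intro x hx
  have hcont : ContinuousAt h x := (hh.continuousOn).continuousAt (hN.mem_nhds hx)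
  have hev : ∀ᶠ y in nhds x, y ∈ N ∧ ‖h y‖ < ‖h x‖ + 1 :=
    (hN.eventually_mem hx).and (hcont.norm.eventually_lt_const (by linarith))
  obtain ⟨r, hr, hball⟩ := Metric.eventually_nhds_iff_ball.1 hev
  set M := ‖h x‖ + 1
  have hM : 0 < M := by positivity
  set L := 2 * M / (r / 2)
  have hL : 0 < L := by positivity
  have hD : ∀ y ∈ Metric.ball x (r / 2), ‖fderiv ℂ h y‖ ≤ L := by
    intro y hy
    have hsub : Metric.ball y (r / 2) ⊆ Metric.ball x r := by
      apply Metric.ball_subset_ball'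
      rw [Metric.mem_ball] at hy
      linarith
    exact norm_fderiv_le_of_norm_le (by positivity)
      (hh.mono fun z hz => (hball z (hsub hz)).1) fun z hz => (hball z (hsub hz)).2.le
  have hdiff : ∀ y ∈ Metric.ball x r, DifferentiableAt ℂ h y := fun y hy =>
    hh.differentiableAt (hN.mem_nhds (hball y hy).1)
  have key : ∀ y ∈ Metric.ball x (r / 4),
      ‖fderiv ℂ h y - fderiv ℂ h x‖ ≤ 2 * (L * ‖y - x‖) / (r / 4) := by
    intro y hy
    rw [Metric.mem_ball, dist_eq_norm] at hy
    have hmem : ∀ z ∈ Metric.ball x (r / 4), z + (y - x) ∈ Metric.ball x (r / 2) := by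
      intro z hz
      rw [Metric.mem_ball, dist_eq_norm] at hz ⊢
      have := norm_add_le (z - x) (y - x)
      rw [show z + (y - x) - x = (z - x) + (y - x) by abel]
      linarith
    have hhalf : Metric.ball x (r / 2) ⊆ Metric.ball x r :=
      Metric.ball_subset_ball (by linarith)
    have hquart : Metric.ball x (r / 4) ⊆ Metric.ball x (r / 2) :=
      Metric.ball_subset_ball (by linarith)
    have hder : ∀ z ∈ Metric.ball x (r / 4), HasFDerivAt (fun z => h (z + (y - x)) - h z)
        (fderiv ℂ h (z + (y - x)) - fderiv ℂ h z) z := by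
      intro z hz
      exact ((hasFDerivAt_comp_add_right (y - x)).2 (hdiff _ (hhalf (hmem z hz))).hasFDerivAt).sub
        (hdiff z (hhalf (hquart hz))).hasFDerivAt
    have hx0 := hder x (Metric.mem_ball_self (by positivity))
    have e : x + (y - x) = y := by abel
    rw [e] at hx0
    rw [← hx0.fderiv]
    refine norm_fderiv_le_of_norm_le (by positivity)
      (fun z hz => (hder z hz).differentiableAt.differentiableWithinAt) ?_
    intro z hz
    let : NormedSpace ℝ E := NormedSpace.restrictScalars ℝ ℂ E
    have := (convex_ball x (r / 2)).norm_image_sub_le_of_norm_fderiv_le (𝕜 := ℂ)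
      (fun w hw => hdiff w (hhalf hw)) hD (hquart hz) (hmem z hz)
    simpa using this
  refine ContinuousAt.continuousWithinAt ?_
  rw [ContinuousAt, tendsto_iff_norm_sub_tendsto_zero]
  refine squeeze_zero' (.of_forall fun _ => norm_nonneg _)
    (Filter.mem_of_superset (Metric.ball_mem_nhds x (by positivity : 0 < r / 4)) key) ?_
  have : ContinuousAt (fun y => 2 * (L * ‖y - x‖) / (r / 4)) x := by fun_prop
  simpa [ContinuousAt] using this

/-- The averages of a holomorphic map over the translates of a fixed closed curve depend
holomorphically on the translation. -/
theorem DifferentiableOn.circleAverage_comp_add [CompleteSpace F] {h : E → F} {N V : Set E}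
    (hN : IsOpen N) (hh : DifferentiableOn ℂ h N) {γ : ℂ → E} (hγ : Continuous γ) (hV : IsOpen V)
    (hVN : ∀ x ∈ V, ∀ ζ : ℂ, ‖ζ‖ = 1 → x + γ ζ ∈ N) :
    DifferentiableOn ℂ (fun x => Real.circleAverage (fun ζ => h (x + γ ζ)) 0 1) V := by
  have hc1 : ∀ θ : ℝ, ‖circleMap 0 1 θ‖ = 1 := fun θ => by simp
  have hcurve : ∀ x : E, Continuous fun θ : ℝ => x + γ (circleMap 0 1 θ) := fun x =>
    continuous_const.add (hγ.comp (continuous_circleMap 0 1))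
  have hmaps : ∀ x ∈ V, ∀ θ : ℝ, x + γ (circleMap 0 1 θ) ∈ N := fun x hx θ => hVN x hx _ (hc1 θ)
  have hcont : ∀ x ∈ V, Continuous fun θ : ℝ => h (x + γ (circleMap 0 1 θ)) := fun x hx =>
    hh.continuousOn.comp_continuous (hcurve x) (hmaps x hx)
  have hcont' : ∀ x ∈ V, Continuous fun θ : ℝ => fderiv ℂ h (x + γ (circleMap 0 1 θ)) :=
    fun x hx => (hh.continuousOn_fderiv_of_isOpen hN).comp_continuous (hcurve x) (hmaps x hx)
  intro x hx
  -- the derivative is bounded on a neighbourhood of the curve through `x`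
  obtain ⟨s, hs, C, hC⟩ : ∃ s ∈ nhds x, ∃ C : ℝ, ∀ y ∈ s, y ∈ V ∧ ∀ θ : ℝ,
      ‖fderiv ℂ h (y + γ (circleMap 0 1 θ))‖ ≤ C := by
    set K := (fun ζ => x + γ ζ) '' Metric.sphere (0 : ℂ) 1
    have hK : IsCompact K := (isCompact_sphere 0 1).image (by fun_prop)
    have hKN : K ⊆ N := by
      rintro _ ⟨ζ, hζ, rfl⟩
      exact hVN x hx ζ (by simpa using hζ)
    have hD := hh.continuousOn_fderiv_of_isOpen hN
    obtain ⟨C, hC⟩ := hK.exists_bound_of_continuousOn (hD.mono hKN)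
    have hop : IsOpen (N ∩ (fderiv ℂ h) ⁻¹' {A | ‖A‖ < C + 1}) :=
      hD.isOpen_inter_preimage hN (isOpen_lt continuous_norm continuous_const)
    obtain ⟨δ, hδ, hsub⟩ := hK.exists_thickening_subset_open hop
      fun y hy => ⟨hKN hy, by have := hC y hy; simp only [mem_preimage, mem_ofPred_eq]; linarith⟩
    refine ⟨V ∩ Metric.ball x δ, Filter.inter_mem (hV.mem_nhds hx) (Metric.ball_mem_nhds x hδ),
      C + 1, fun y hy => ⟨hy.1, fun θ => ?_⟩⟩
    refine (hsub (Metric.mem_thickening_iff.2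
      ⟨x + γ (circleMap 0 1 θ), ⟨_, by simp, rfl⟩, ?_⟩)).2.le
    simpa using hy.2
  refine DifferentiableAt.differentiableWithinAt ?_
  have := intervalIntegral.hasFDerivAt_integral_of_dominated_of_fderiv_le (𝕜 := ℂ)
    (μ := MeasureTheory.volume) (a := 0) (b := 2 * Real.pi) (bound := fun _ => C)
    (F := fun y θ => h (y + γ (circleMap 0 1 θ)))
    (F' := fun y θ => fderiv ℂ h (y + γ (circleMap 0 1 θ))) hs
    (Filter.mem_of_superset hs fun y hy => (hcont y (hC y hy).1).aestronglyMeasurable)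
    ((hcont x hx).intervalIntegrable _ _)
    (hcont' x hx).aestronglyMeasurable
    (.of_forall fun θ _ y hy => (hC y hy).2 θ)
    intervalIntegrable_const
    (.of_forall fun θ _ y hy => (hasFDerivAt_comp_add_right _).2 (hh.differentiableAt
      (hN.mem_nhds (hmaps y (hC y hy).1 θ))).hasFDerivAt)
  have h2 := this.differentiableAt.const_smul ((2 * Real.pi)⁻¹ : ℝ)
  exact h2

/-- Averages of values in a ball lie in the closed ball. -/
theorem norm_circleAverage_sub_le [CompleteSpace F] {u : ℂ → F} {c : F} {r : ℝ}
    (hu : ContinuousOn u (Metric.sphere 0 1)) (hr : ∀ ζ : ℂ, ‖ζ‖ = 1 → ‖u ζ - c‖ ≤ r) :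
    ‖Real.circleAverage u 0 1 - c‖ ≤ r := by
  have hint : CircleIntegrable u 0 1 := by
    refine ContinuousOn.circleIntegrable (by simp) hu
  have e : Real.circleAverage u 0 1 - c = Real.circleAverage (fun ζ => u ζ - c) 0 1 := by
    have := Real.circleAverage_sub hint (circleIntegrable_const c 0 1)
    rw [Real.circleAverage_const] at this
    exact this.symm
  rw [e, Real.circleAverage_def, norm_smul]
  have h1 := intervalIntegral.norm_integral_le_of_norm_le_const (a := 0) (b := 2 * Real.pi)
    (f := fun θ => u (circleMap 0 1 θ) - c) (C := r) fun θ _ => hr _ (by simp)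
  have hpi := Real.pi_pos
  rw [sub_zero, abs_of_pos (by positivity)] at h1
  rw [Real.norm_of_nonneg (by positivity)]
  calc (2 * Real.pi)⁻¹ * _ ≤ (2 * Real.pi)⁻¹ * (r * (2 * Real.pi)) := by gcongr
    _ = r := by field_simp

end HolomorphicMaps

/-! ### The identity theorem for holomorphic maps of one variable into a manifold -/

section Identity

variable {F : Type*} [NormedAddCommGroup F] [NormedSpace ℂ F] [CompleteSpace F]
  {Y : Type*} [TopologicalSpace Y] [ChartedSpace F Y] [IsManifold 𝓘(ℂ, F) ω Y]

/-- Near a point of an open set, a holomorphic map into a manifold is analytic in the chart at the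
image point. -/
theorem MDifferentiableOn.analyticAt_chart {f : ℂ → Y} {U : Set ℂ} (hU : IsOpen U)
    (hf : MDifferentiableOn 𝓘(ℂ, ℂ) 𝓘(ℂ, F) f U) {z : ℂ} (hz : z ∈ U) {y : Y}
    (hy : f z ∈ (chartAt F y).source) :
    AnalyticAt ℂ (chartAt F y ∘ f) z := by
  have : IsManifold 𝓘(ℂ, F) 1 Y := .of_le (n := ω) (by simp)
  rw [Complex.analyticAt_iff_eventually_differentiableAt]
  have hc : ContinuousAt f z := (hf.continuousOn).continuousAt (hU.mem_nhds hz)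
  filter_upwards [hU.mem_nhds hz, hc.preimage_mem_nhds ((chartAt F y).open_source.mem_nhds hy)]
    with w hw hwy
  have h1 := (mdifferentiableAt_iff_target_of_mem_source hwy).1
    (hf.mdifferentiableAt (hU.mem_nhds hw))
  exact mdifferentiableAt_iff_differentiableAt.1 h1.2

theorem MDifferentiableOn.eqOn_of_preconnected_of_eventuallyEq [T2Space Y] {f g : ℂ → Y} {U : Set ℂ}
    (hU : IsOpen U) (hUc : IsPreconnected U)
    (hf : MDifferentiableOn 𝓘(ℂ, ℂ) 𝓘(ℂ, F) f U) (hg : MDifferentiableOn 𝓘(ℂ, ℂ) 𝓘(ℂ, F) g U)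
    {z₀ : ℂ} (hz₀ : z₀ ∈ U) (hfg : f =ᶠ[nhds z₀] g) : EqOn f g U := by
  set A : Set ℂ := {z | f =ᶠ[nhds z] g}
  have hA : IsOpen A := isOpen_setOfPred_eventually_nhds
  suffices U ⊆ A from fun z hz => (this hz).eq_of_nhds
  refine hUc.subset_of_closure_inter_subset hA ⟨z₀, hz₀, hfg⟩ ?_
  rintro z ⟨hzA, hzU⟩
  have hfc : ContinuousAt f z := (hf.continuousOn).continuousAt (hU.mem_nhds hzU)
  have hgc : ContinuousAt g z := (hg.continuousOn).continuousAt (hU.mem_nhds hzU)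
  have hfreq : ∃ᶠ w in nhds z, f w = g w :=
    (mem_closure_iff_frequently.1 hzA).mono fun w hw => hw.eq_of_nhds
  have hne : ∃ᶠ w in nhdsWithin z {z}ᶜ, f w = g w := by
    rw [frequently_nhdsWithin_iff]
    have : ∃ᶠ w in nhds z, w ∈ A := mem_closure_iff_frequently.1 hzA
    rw [Filter.frequently_iff]
    intro S hS
    obtain ⟨w, hwS, hw⟩ := Filter.frequently_iff.1 this (interior_mem_nhds.2 hS)
    have hw2 : ∀ᶠ w' in nhdsWithin w {w}ᶜ, (w' ∈ S ∧ f w' = g w') ∧ w' ≠ z := by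
      refine Filter.Eventually.and ?_ ?_
      · exact nhdsWithin_le_nhds (((isOpen_interior.eventually_mem hwS).mono
          fun _ h => interior_subset h).and hw)
      · rcases eq_or_ne w z with rfl | hwz
        · exact self_mem_nhdsWithin
        · exact nhdsWithin_le_nhds (isOpen_ne.mem_nhds hwz)
    obtain ⟨w', hw'⟩ := hw2.exists
    exact ⟨w', hw'.1.1, hw'.1.2, hw'.2⟩
  -- by continuity the two maps agree at `z`, so that one chart serves both
  have hval : f z = g z := by
    by_contra hne'
    obtain ⟨O₁, O₂, hO₁, hO₂, h1, h2, hdisj⟩ := t2_separation hne'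
    obtain ⟨w, hw, hw1, hw2⟩ := (hfreq.and_eventually ((hfc.eventually
      (hO₁.eventually_mem h1)).and (hgc.eventually (hO₂.eventually_mem h2)))).exists
    exact hdisj.le_bot ⟨hw1, by rw [hw]; exact hw2⟩
  set φ := chartAt F (f z)
  have hfs : f z ∈ φ.source := mem_chart_source F (f z)
  have hgs : g z ∈ φ.source := hval ▸ hfs
  have heq := ((hf.analyticAt_chart hU hzU hfs).frequently_eq_iff_eventually_eq
    (hg.analyticAt_chart hU hzU hgs)).1 (hne.mono fun w hw => by simp [hw])
  filter_upwards [heq, hfc.preimage_mem_nhds (φ.open_source.mem_nhds hfs),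
    hgc.preimage_mem_nhds (φ.open_source.mem_nhds hgs)] with w hw hwf hwg
  exact φ.injOn hwf hwg hw

end Identity

/-! ### Second order expansion along a complex subspace -/

section Expansion

theorem ContDiffAt.exists_abs_taylor_two_le {E : Type*} [NormedAddCommGroup E] [NormedSpace ℝ E]
    {u : E → ℝ} {a : E} (hu : ContDiffAt ℝ 2 u a) {η : ℝ} (hη : 0 < η) :
    ∃ δ > 0, ∀ h : E, ‖h‖ < δ →
      |u (a + h) - u a - fderiv ℝ u a h - fderiv ℝ (fderiv ℝ u) a h h / 2| ≤ η * ‖h‖ ^ 2 := by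
  set l := fderiv ℝ u a
  set B := fderiv ℝ (fderiv ℝ u) a
  have hB : HasFDerivAt (fderiv ℝ u) B a :=
    ((hu.fderiv_right (m := 1) (by norm_num)).differentiableAt (by norm_num)).hasFDerivAt
  have hsymm : ∀ v w, B v w = B w v := hu.isSymmSndFDerivAt (by simp)
  have hdiff : ∀ᶠ x in nhds a, DifferentiableAt ℝ u x :=
    (hu.eventually (by simp)).mono fun x hx => hx.differentiableAt (by norm_num)
  have hlo := (hasFDerivAt_iff_isLittleO.1 hB).def hη
  obtain ⟨δ, hδ, hball⟩ := Metric.eventually_nhds_iff_ball.1 (hdiff.and hlo)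
  refine ⟨δ, hδ, fun h hh => ?_⟩
  -- the remainder has derivative at most `η ‖x‖` at `a + x`
  set k : E → ℝ := fun x => u (a + x) - u a - l x - B x x / 2
  have hmem : ∀ x ∈ Metric.closedBall (0 : E) ‖h‖, a + x ∈ Metric.ball a δ := by
    intro x hx
    rw [mem_closedBall_zero_iff] at hx
    simpa using hx.trans_lt hh
  have hk : ∀ x ∈ Metric.closedBall (0 : E) ‖h‖,
      HasFDerivAt k (fderiv ℝ u (a + x) - l - B x) x := by
    intro x hx
    have h1 : HasFDerivAt (fun x => u (a + x)) (fderiv ℝ u (a + x)) x :=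
      (hasFDerivAt_comp_add_left a).2 (hball _ (hmem x hx)).1.hasFDerivAt
    have h2 : HasFDerivAt (fun x => B x x / 2) (B x) x := by
      have := (B.hasFDerivAt (x := x)).clm_apply (hasFDerivAt_id x)
      have h3 := this.const_mul (1 / 2 : ℝ)
      refine (h3.congr_fderiv ?_).congr_of_eventuallyEq (.of_forall fun y => ?_)
      · ext v
        simp [hsymm v x]
        ring
      · simp
        ring
    exact ((h1.sub_const _).sub l.hasFDerivAt).sub h2
  have hbound : ∀ x ∈ Metric.closedBall (0 : E) ‖h‖, ‖fderiv ℝ u (a + x) - l - B x‖ ≤ η * ‖h‖ := by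
    intro x hx
    have := (hball _ (hmem x hx)).2
    rw [mem_closedBall_zero_iff] at hx
    simp only [add_sub_cancel_left] at this
    exact this.trans (by gcongr)
  have := (convex_closedBall (0 : E) ‖h‖).norm_image_sub_le_of_norm_hasFDerivWithin_le
    (fun x hx => (hk x hx).hasFDerivWithinAt) hbound
    (x := 0) (y := h) (by simp) (by simp)
  have h0 : k 0 = 0 := by simp [k]
  rw [h0, sub_zero, sub_zero, Real.norm_eq_abs] at this
  calc _ = |k h| := rfl
    _ ≤ _ := this
    _ = _ := by ring

variable {E : Type*} [NormedAddCommGroup E] [NormedSpace ℂ E]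

theorem Complex.smul_eq_re_add_im (c : ℂ) (v : E) :
    c • v = c.re • v + c.im • (Complex.I • v) := by
  rw [← Complex.coe_smul c.re, ← Complex.coe_smul c.im, smul_smul, ← add_smul, Complex.re_add_im]

/-- The complex bilinear part of a real bilinear form: a real quadratic form is the sum of a
Hermitian form and of the real part of a complex quadratic form. -/
theorem exists_complexBilinear_re_eq (B : E →L[ℝ] E →L[ℝ] ℝ) :
    ∃ P : E →L[ℂ] E →L[ℂ] ℂ, ∀ v,
      (P v v).re = (B v v - B (Complex.I • v) (Complex.I • v)) / 2 := by
  have hI : ∀ v : E, Complex.I • Complex.I • v = -v := fun v => by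
    rw [smul_smul, Complex.I_mul_I, neg_one_smul]
  have hc : ∀ (c : ℂ) (v : E), Complex.I • c • v = c.re • (Complex.I • v) - c.im • v := by
    intro c v
    rw [smul_comm, Complex.smul_eq_re_add_im, hI, smul_neg, sub_eq_add_neg]
  let P₀ : E →ₗ[ℂ] E →ₗ[ℂ] ℂ := LinearMap.mk₂ ℂ
    (fun u v => ⟨(B u v - B (Complex.I • u) (Complex.I • v)) / 2,
      -(B u (Complex.I • v) + B (Complex.I • u) v) / 2⟩)
    (fun u₁ u₂ v => by
      apply Complex.ext <;> simp only [smul_add, map_add, add_apply,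
        Complex.add_re, Complex.add_im] <;> ring)
    (fun c u v => by
      rw [Complex.smul_eq_re_add_im c u]
      apply Complex.ext <;> simp only [smul_add, map_add, add_apply,
        ContinuousLinearMap.map_smul, smul_apply, smul_comm Complex.I c.re,
        smul_comm Complex.I c.im, hI, map_neg, neg_apply,
        smul_eq_mul, Complex.mul_re, Complex.mul_im] <;> ring)
    (fun u v₁ v₂ => by
      apply Complex.ext <;> simp only [smul_add, map_add,
        Complex.add_re, Complex.add_im] <;> ring)
    (fun c u v => by
      rw [Complex.smul_eq_re_add_im c v]
      apply Complex.ext <;> simp only [smul_add, map_add,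
        ContinuousLinearMap.map_smul, smul_comm Complex.I c.re,
        smul_comm Complex.I c.im, hI, map_neg,
        smul_eq_mul, Complex.mul_re, Complex.mul_im] <;> ring)
  have hbound : ∀ u v, ‖P₀ u v‖ ≤ (2 * ‖B‖) * ‖u‖ * ‖v‖ := by
    intro u v
    have hle : ∀ x y : E, ‖x‖ = ‖u‖ → ‖y‖ = ‖v‖ → |B x y| ≤ ‖B‖ * ‖u‖ * ‖v‖ := by
      intro x y hx hy
      rw [← hx, ← hy]
      exact B.le_opNorm₂ x y
    have hn : ∀ x : E, ‖Complex.I • x‖ = ‖x‖ := fun x => by simp [norm_smul]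
    have h1 := abs_le.1 (hle u v rfl rfl)
    have h2 := abs_le.1 (hle _ _ (hn u) (hn v))
    have h3 := abs_le.1 (hle _ _ rfl (hn v) : |B u (Complex.I • v)| ≤ _)
    have h4 := abs_le.1 (hle _ _ (hn u) rfl : |B (Complex.I • u) v| ≤ _)
    refine (Complex.norm_le_abs_re_add_abs_im _).trans ?_
    have e1 : |(P₀ u v).re| ≤ ‖B‖ * ‖u‖ * ‖v‖ := by
      change |(B u v - B (Complex.I • u) (Complex.I • v)) / 2| ≤ _
      rw [abs_le]
      constructor <;> linarith [h1.1, h1.2, h2.1, h2.2]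
    have e2 : |(P₀ u v).im| ≤ ‖B‖ * ‖u‖ * ‖v‖ := by
      change |-(B u (Complex.I • v) + B (Complex.I • u) v) / 2| ≤ _
      rw [abs_le]
      constructor <;> linarith [h3.1, h3.2, h4.1, h4.2]
    linarith
  exact ⟨P₀.mkContinuous₂ _ hbound, fun v => rfl⟩

open HartogsHilbert in
/-- The quadratic correction `- P(v, v) / 2` in the normal direction removes the pluriharmonic part
of the second order term, so that the Levi form is all that remains of it. In the anisotropic scaling
`(ε, ε²)` of tangential and normal directions the error is uniformly small. -/
theorem exists_scale_le_complexHessian {u : E → ℝ} {a : E} (hu : ContDiffAt ℝ 2 u a)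
    (h0 : u a = 0) {n : E} (hn : ∀ c : ℂ, fderiv ℝ u a (c • n) = c.re)
    {P : E →L[ℂ] E →L[ℂ] ℂ} (hP : ∀ v, (P v v).re = (fderiv ℝ (fderiv ℝ u) a v v -
      fderiv ℝ (fderiv ℝ u) a (Complex.I • v) (Complex.I • v)) / 2)
    {M η : ℝ} (hM : 0 < M) (hη : 0 < η) :
    ∃ ε₀ > 0, ∀ ε : ℝ, 0 < ε → ε ≤ ε₀ → ∀ v ∈ complexTangentSpace u a, ‖v‖ ≤ M →
      ∀ w : ℂ, ‖w‖ ≤ M →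
      u (a + (ε • v + ((ε : ℂ) ^ 2 * (w - P v v / 2)) • n)) ≤
        ε ^ 2 * (w.re + complexHessian u a v + η) := by
  set l := fderiv ℝ u a
  set B := fderiv ℝ (fderiv ℝ u) a
  set C := M + ‖P‖ * M * M / 2
  have hC : 0 < C := by positivity
  set K := M + C * ‖n‖
  have hK : 0 < K := by positivity
  obtain ⟨δ, hδ, hT⟩ := hu.exists_abs_taylor_two_le (η := η / (2 * K ^ 2)) (by positivity)
  refine ⟨min 1 (min (δ / (2 * K)) (η / (‖B‖ * K ^ 2 + 1))), by positivity, ?_⟩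
  intro ε hε hε₀ v hv hvM w hw
  have hε1 : ε ≤ 1 := hε₀.trans (min_le_left _ _)
  have hε2 : ε ≤ δ / (2 * K) := hε₀.trans ((min_le_right _ _).trans (min_le_left _ _))
  have hε3 : ε ≤ η / (‖B‖ * K ^ 2 + 1) := hε₀.trans ((min_le_right _ _).trans (min_le_right _ _))
  rw [le_div_iff₀ (by positivity)] at hε2 hε3
  set c := w - P v v / 2
  have hPv : ‖P v v‖ ≤ ‖P‖ * M * M := (P.le_opNorm₂ v v).trans (by gcongr)
  have hc : ‖c‖ ≤ C := by
    refine (norm_sub_le _ _).trans ?_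
    rw [norm_div, Complex.norm_ofNat]
    simp only [C]
    linarith
  have hcn : ‖c • n‖ ≤ C * ‖n‖ := by
    rw [norm_smul]
    gcongr
  set h := ε • v + ((ε : ℂ) ^ 2 * c) • n
  have e : h = ε • v + ε ^ 2 • (c • n) := by
    simp only [h, mul_smul]
    rw [← Complex.ofReal_pow, Complex.coe_smul]
  have hh : ‖h‖ ≤ ε * K := by
    rw [e]
    refine (norm_add_le _ _).trans ?_
    rw [norm_smul, norm_smul, Real.norm_of_nonneg hε.le, Real.norm_of_nonneg (by positivity)]
    calc ε * ‖v‖ + ε ^ 2 * ‖c • n‖ ≤ ε * M + (ε * 1) * (C * ‖n‖) := by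
          rw [sq]; gcongr
      _ = ε * K := by simp only [K]; ring
  have hlh : l h = ε ^ 2 * c.re := by
    rw [e, map_add, map_smul, map_smul, hn, hv.1]
    simp
  have hBh : B h h ≤ ε ^ 2 * B v v + ε ^ 3 * (‖B‖ * K ^ 2) := by
    have e2 : B h h = ε ^ 2 * B v v + ε ^ 3 * (B v (c • n) + B (c • n) v)
        + ε ^ 4 * B (c • n) (c • n) := by
      rw [e]
      simp only [map_add, map_smul, add_apply, smul_apply,
        smul_eq_mul]
      ring
    have b1 : B v (c • n) ≤ ‖B‖ * M * (C * ‖n‖) :=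
      (le_abs_self _).trans ((B.le_opNorm₂ _ _).trans (by gcongr))
    have b2 : B (c • n) v ≤ ‖B‖ * (C * ‖n‖) * M :=
      (le_abs_self _).trans ((B.le_opNorm₂ _ _).trans (by gcongr))
    have b3 : B (c • n) (c • n) ≤ ‖B‖ * (C * ‖n‖) * (C * ‖n‖) :=
      (le_abs_self _).trans ((B.le_opNorm₂ _ _).trans (by gcongr))
    have b4 : ε ^ 4 * B (c • n) (c • n) ≤ ε ^ 3 * (‖B‖ * (C * ‖n‖) * (C * ‖n‖)) := by
      calc ε ^ 4 * B (c • n) (c • n) ≤ ε ^ 4 * (‖B‖ * (C * ‖n‖) * (C * ‖n‖)) := by gcongr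
        _ ≤ ε ^ 3 * (‖B‖ * (C * ‖n‖) * (C * ‖n‖)) := by
          gcongr ?_ * _
          exact pow_le_pow_of_le_one hε.le hε1 (by norm_num)
    have b5 : ε ^ 3 * (B v (c • n) + B (c • n) v) ≤
        ε ^ 3 * (‖B‖ * M * (C * ‖n‖) + ‖B‖ * (C * ‖n‖) * M) := by gcongr
    have b6 : 0 ≤ ε ^ 3 * (‖B‖ * M ^ 2) := by positivity
    have b7 : ε ^ 3 * (‖B‖ * K ^ 2) = ε ^ 3 * (‖B‖ * M ^ 2) +
        ε ^ 3 * (‖B‖ * M * (C * ‖n‖) + ‖B‖ * (C * ‖n‖) * M) +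
        ε ^ 3 * (‖B‖ * (C * ‖n‖) * (C * ‖n‖)) := by
      simp only [K]
      ring
    linarith
  have hlt : ‖h‖ < δ := hh.trans_lt (by linarith)
  have hTh := (abs_le.1 (hT h hlt)).2
  have hsq : η / (2 * K ^ 2) * ‖h‖ ^ 2 ≤ ε ^ 2 * (η / 2) := by
    calc η / (2 * K ^ 2) * ‖h‖ ^ 2 ≤ η / (2 * K ^ 2) * (ε * K) ^ 2 := by gcongr
      _ = ε ^ 2 * (η / 2) := by field_simp
  have hcube : ε ^ 3 * (‖B‖ * K ^ 2) ≤ ε ^ 2 * η := by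
    have : ε * (‖B‖ * K ^ 2) ≤ η := by linarith
    calc ε ^ 3 * (‖B‖ * K ^ 2) = ε ^ 2 * (ε * (‖B‖ * K ^ 2)) := by ring
      _ ≤ ε ^ 2 * η := by gcongr
  have hre : c.re = w.re - (B v v - B (Complex.I • v) (Complex.I • v)) / 4 := by
    have : (P v v / 2).re = (P v v).re / 2 := by simp
    rw [Complex.sub_re, this, hP]
    ring
  have hH : complexHessian u a v = (B v v + B (Complex.I • v) (Complex.I • v)) / 4 := rfl
  rw [h0, hlh, hre] at hTh
  rw [hH]
  linarith

end Expansion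

/-! ### Coordinates adapted to a pseudoconcave boundary point -/

theorem Convex.sub_smul_mem_of_mem_Icc {E : Type*} [AddCommGroup E] [Module ℝ E] {s : Set E}
    (hs : Convex ℝ s) {x n : E} {τ t : ℝ} (hx : x ∈ s) (hxτ : x - τ • n ∈ s) (ht : t ∈ Icc 0 τ) :
    x - t • n ∈ s := by
  rcases (ht.1.trans ht.2).eq_or_lt with rfl | hτ
  · have : t = 0 := le_antisymm ht.2 ht.1
    simpa [this] using hx
  · have := hs hx hxτ (a := 1 - t / τ) (b := t / τ)
      (by have := div_le_one_of_le₀ ht.2 hτ.le; linarith) (by have := ht.1; positivity) (by ring)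
    convert this using 1
    rw [smul_sub, smul_smul, div_mul_cancel₀ _ hτ.ne', sub_smul, one_smul]
    abel

namespace HartogsHilbert

section Adapted

variable {E : Type*} [NormedAddCommGroup E] [NormedSpace ℂ E]

/-- A holomorphic map `Ψ : ℂ^q × ℂ → E` adapted to the side `{u < 0}` of a hypersurface near its
point `a`, with respect to a ball around `a` of radius `η`. The last variable moves along the
transverse vector `n`, on whose lines `u` is increasing, and up to errors that are small in the
anisotropic scaling `(ε, ε²)`, the set `{u ∘ Ψ < 0}` contains `{re w < c ‖z‖²}`. -/
structure IsAdapted (u : E → ℝ) (a : E) (η : ℝ) (n : E) {q : ℕ} (Ψ : (Fin q → ℂ) × ℂ → E)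
    (c : ℝ) : Prop where
  continuousOn : ContinuousOn u (Metric.ball a η)
  descend : ∀ x ∈ Metric.ball a η, ∀ τ : ℝ, 0 ≤ τ → x - (τ : ℂ) • n ∈ Metric.ball a η →
    u x < 0 → u (x - (τ : ℂ) • n) < 0
  differentiable : Differentiable ℂ Ψ
  map_zero : Ψ 0 = a
  map_add : ∀ z w t, Ψ (z, w + t) = Ψ (z, w) + t • n
  pos : 0 < c
  scale : ∀ M κ : ℝ, 0 < M → 0 < κ → ∃ ε₀ > 0, ∀ ε : ℝ, 0 < ε → ε ≤ ε₀ →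
    ∀ z : Fin q → ℂ, ‖z‖ ≤ 1 → ∀ w : ℂ, ‖w‖ ≤ M →
      Ψ ((ε : ℂ) • z, (ε : ℂ) ^ 2 * w) ∈ Metric.ball a η ∧
      (w.re - c * ‖z‖ ^ 2 ≤ -κ → u (Ψ ((ε : ℂ) • z, (ε : ℂ) ^ 2 * w)) < 0)

theorem IsAdapted.isOpen {u : E → ℝ} {a : E} {η : ℝ} {n : E} {q : ℕ}
    {Ψ : (Fin q → ℂ) × ℂ → E} {c : ℝ} (h : IsAdapted u a η n Ψ c) :
    IsOpen {x ∈ Metric.ball a η | u x < 0} :=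
  h.continuousOn.isOpen_inter_preimage Metric.isOpen_ball isOpen_Iio

theorem complexHessian_real_smul (u : E → ℝ) (a v : E) (t : ℝ) :
    complexHessian u a (t • v) = t ^ 2 * complexHessian u a v := by
  simp only [complexHessian, smul_comm Complex.I t, map_smul, smul_apply,
    smul_eq_mul]
  ring

theorem continuous_complexHessian (u : E → ℝ) (a : E) : Continuous (complexHessian u a) := by
  unfold complexHessian
  fun_prop

/-- A form that is negative definite on a finite dimensional subspace is bounded above there by a
negative multiple of the square of a norm. -/
theorem exists_complexHessian_le {u : E → ℝ} {a : E} {q : ℕ} (A : (Fin q → ℂ) →L[ℂ] E)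
    (hA : ∀ z, z ≠ 0 → complexHessian u a (A z) < 0) :
    ∃ c > 0, ∀ z, complexHessian u a (A z) ≤ -c * ‖z‖ ^ 2 := by
  have hcont : Continuous fun z => complexHessian u a (A z) :=
    (continuous_complexHessian u a).comp A.continuous
  obtain ⟨c, hc, hle⟩ : ∃ c > 0, ∀ z ∈ Metric.sphere (0 : Fin q → ℂ) 1,
      complexHessian u a (A z) ≤ -c := by
    rcases (Metric.sphere (0 : Fin q → ℂ) 1).eq_empty_or_nonempty with he | hne
    · exact ⟨1, one_pos, by simp [he]⟩
    · obtain ⟨z₀, hz₀, hmax⟩ := (isCompact_sphere (0 : Fin q → ℂ) 1).exists_isMaxOn hne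
        hcont.continuousOn
      refine ⟨-complexHessian u a (A z₀), ?_, fun z hz => by simpa using hmax hz⟩
      have : z₀ ≠ 0 := by
        rintro rfl
        simp at hz₀
      linarith [hA z₀ this]
  refine ⟨c, hc, fun z => ?_⟩
  rcases eq_or_ne z 0 with rfl | hz
  · simp [complexHessian]
  · have hz' : ‖z‖ ≠ 0 := by simpa using hz
    have h1 := hle (‖z‖⁻¹ • z) (by simp [norm_smul, hz'])
    have e : A z = ‖z‖ • A (‖z‖⁻¹ • z) := by
      rw [← Complex.coe_smul, ← map_smul, Complex.coe_smul, smul_inv_smul₀ hz']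
    rw [e, complexHessian_real_smul]
    nlinarith [sq_nonneg ‖z‖]

/-- A real functional that does not vanish takes the value `re c` at `c • n` for some vector `n`. -/
theorem exists_apply_smul_eq_re {l : E →L[ℝ] ℝ} (hl : l ≠ 0) :
    ∃ n : E, ∀ c : ℂ, l (c • n) = c.re := by
  obtain ⟨v, hv⟩ : ∃ v, l v ≠ 0 := by
    by_contra! h
    exact hl (ContinuousLinearMap.ext h)
  -- `d` is the value at `v` of the complex functional with real part `l`
  set d : ℂ := ⟨l v, -l (Complex.I • v)⟩
  have hd : d ≠ 0 := fun h => hv (by simpa [d] using congrArg Complex.re h)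
  have key : ∀ c : ℂ, l (c • v) = (c * d).re := by
    intro c
    rw [Complex.smul_eq_re_add_im, map_add, map_smul, map_smul, Complex.mul_re]
    simp only [smul_eq_mul, d]
    ring
  refine ⟨d⁻¹ • v, fun c => ?_⟩
  rw [smul_smul, key, mul_assoc, inv_mul_cancel₀ hd, mul_one]

theorem exists_isAdapted {q : ℕ} (hq : 0 < q) {u : E → ℝ} {a : E} (hu : ContDiffAt ℝ 2 u a)
    (h0 : u a = 0) (hl : fderiv ℝ u a ≠ 0) {W : Submodule ℂ E} (hW : Module.finrank ℂ W = q)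
    (hWt : W ≤ complexTangentSpace u a) (hneg : ∀ v ∈ W, v ≠ 0 → complexHessian u a v < 0)
    {O : Set E} (hO : O ∈ nhds a) :
    ∃ (η : ℝ) (n : E) (Ψ : (Fin q → ℂ) × ℂ → E) (c : ℝ), 0 < η ∧ Metric.ball a η ⊆ O ∧
      IsAdapted u a η n Ψ c := by
  obtain ⟨n, hn⟩ := exists_apply_smul_eq_re hl
  obtain ⟨P, hP⟩ := exists_complexBilinear_re_eq (fderiv ℝ (fderiv ℝ u) a)
  have : Module.Finite ℂ W := Module.finite_of_finrank_pos (by omega)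
  let e : (Fin q → ℂ) ≃ₗ[ℂ] W := LinearEquiv.ofFinrankEq _ _ (by simp [hW])
  let A : (Fin q → ℂ) →L[ℂ] E := LinearMap.toContinuousLinearMap (W.subtype ∘ₗ e.toLinearMap)
  have hAW : ∀ z, A z ∈ W := fun z => (e z).2
  obtain ⟨c, hc, hAc⟩ := exists_complexHessian_le (u := u) (a := a) A fun z hz =>
    hneg _ (hAW z) fun h => hz (e.map_eq_zero_iff.1 (Subtype.ext h))
  have hn1 : fderiv ℝ u a n = 1 := by simpa using hn 1
  have hcf : ContinuousAt (fderiv ℝ u) a :=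
    (hu.fderiv_right (m := 1) (by norm_num)).continuousAt
  have hev : ∀ᶠ x in nhds a, x ∈ O ∧ DifferentiableAt ℝ u x ∧ 0 < fderiv ℝ u x n := by
    refine (Filter.eventually_of_mem hO fun x hx => hx).and (.and ?_ ?_)
    · exact (hu.eventually (by simp)).mono fun x hx => hx.differentiableAt (by norm_num)
    · have : ContinuousAt (fun x => fderiv ℝ u x n) a := hcf.clm_apply continuousAt_const
      exact this.eventually_const_lt (by simp only [hn1, one_pos])
  obtain ⟨η, hη, hball⟩ := Metric.eventually_nhds_iff_ball.1 hev
  let Ψ : (Fin q → ℂ) × ℂ → E := fun p => a + (A p.1 + (p.2 - P (A p.1) (A p.1) / 2) • n)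
  have hΨ : Differentiable ℂ Ψ := by
    have : Differentiable ℂ fun p : (Fin q → ℂ) × ℂ => P (A p.1) (A p.1) := fun p =>
      DifferentiableAt.clm_apply (by fun_prop) (by fun_prop)
    fun_prop
  have hΨ0 : Ψ 0 = a := by simp [Ψ]
  refine ⟨η, n, Ψ, c, hη, fun x hx => (hball x hx).1, ?_, ?_, hΨ, hΨ0, ?_, hc, ?_⟩
  · exact fun x hx => (hball x hx).2.1.continuousAt.continuousWithinAt
  · intro x hx τ hτ hxτ hux
    rw [Complex.coe_smul] at hxτ ⊢
    have hseg : ∀ t ∈ Icc 0 τ, x - t • n ∈ Metric.ball a η := fun t ht =>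
      (convex_ball a η).sub_smul_mem_of_mem_Icc hx hxτ ht
    have hder : ∀ t ∈ Icc 0 τ, HasDerivAt (fun t : ℝ => u (x - t • n))
        (fderiv ℝ u (x - t • n) (-n)) t := by
      intro t ht
      have h1 : HasDerivAt (fun t : ℝ => x - t • n) (-n) t := by
        simpa using ((hasDerivAt_id t).smul_const n).const_sub x
      exact (hball _ (hseg t ht)).2.1.hasFDerivAt.comp_hasDerivAt t h1
    have hanti : AntitoneOn (fun t : ℝ => u (x - t • n)) (Icc 0 τ) := by
      refine antitoneOn_of_deriv_nonpos (convex_Icc 0 τ)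
        (fun t ht => (hder t ht).continuousAt.continuousWithinAt)
        (fun t ht => (hder t (interior_subset ht)).differentiableAt.differentiableWithinAt) ?_
      intro t ht
      rw [(hder t (interior_subset ht)).deriv, map_neg]
      have := (hball _ (hseg t (interior_subset ht))).2.2
      linarith
    have := hanti (left_mem_Icc.2 hτ) (right_mem_Icc.2 hτ) hτ
    simp only [zero_smul, sub_zero] at this
    linarith
  · intro z w t
    simp only [Ψ, add_sub_right_comm, add_smul]
    abel
  · intro M κ hM hκ
    obtain ⟨ε₁, hε₁, h1⟩ := exists_scale_le_complexHessian hu h0 hn hP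
      (M := ‖A‖ + M) (η := κ / 2) (by positivity) (by positivity)
    obtain ⟨δ, hδ, h2⟩ := Metric.continuousAt_iff.1 (hΨ.continuous.continuousAt (x := 0)) η hη
    refine ⟨min ε₁ (min 1 (δ / (2 * (1 + M)))), by positivity, ?_⟩
    intro ε hε hε₀ z hz w hw
    have hle1 : ε ≤ ε₁ := hε₀.trans (min_le_left _ _)
    have hle2 : ε ≤ 1 := hε₀.trans ((min_le_right _ _).trans (min_le_left _ _))
    have hle3 : ε ≤ δ / (2 * (1 + M)) := hε₀.trans ((min_le_right _ _).trans (min_le_right _ _))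
    rw [le_div_iff₀ (by positivity)] at hle3
    have hεn : ‖(ε : ℂ)‖ = ε := by simp [abs_of_pos hε]
    constructor
    · rw [hΨ0] at h2
      refine h2 ?_
      rw [dist_zero_right, Prod.norm_def, max_lt_iff, norm_smul, norm_mul, norm_pow, hεn]
      have h3 : ε * ‖z‖ ≤ ε * 1 := by gcongr
      have h4 : ε ^ 2 * ‖w‖ ≤ (ε * 1) * M := by rw [sq]; gcongr
      have h5 : 0 < ε * M := by positivity
      constructor <;> nlinarith
    · intro hκw
      have hAz : ‖A z‖ ≤ ‖A‖ + M := by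
        have := A.le_opNorm z
        nlinarith [norm_nonneg A]
      have := h1 ε hε hle1 (A z) (hWt (hAW z)) hAz w (by linarith [norm_nonneg A])
      have eΨ : Ψ ((ε : ℂ) • z, (ε : ℂ) ^ 2 * w) =
          a + (ε • A z + ((ε : ℂ) ^ 2 * (w - P (A z) (A z) / 2)) • n) := by
        have eA : A ((ε : ℂ) • z) = (ε : ℂ) • A z := A.map_smul _ _
        have eP : P ((ε : ℂ) • A z) ((ε : ℂ) • A z) = (ε : ℂ) ^ 2 * P (A z) (A z) := by
          rw [map_smul, map_smul, smul_apply, smul_eq_mul, smul_eq_mul]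
          ring
        simp only [Ψ]
        rw [eA, eP, Complex.coe_smul, mul_sub, mul_div_assoc]
      rw [eΨ]
      refine this.trans_lt ?_
      have h3 := hAc z
      have h4 : 0 < ε ^ 2 := by positivity
      nlinarith

end Adapted

end HartogsHilbert

/-! ### Extension in local coordinates -/

namespace HartogsHilbert

section LocalExtension

variable {E : Type*} [NormedAddCommGroup E] [NormedSpace ℂ E]
  {F : Type*} [NormedAddCommGroup F] [NormedSpace ℂ F] [CompleteSpace F]
  {Y : Type*} [TopologicalSpace Y] [T2Space Y] [ChartedSpace F Y] [IsManifold 𝓘(ℂ, F) ω Y]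

/-- Agreement of two holomorphic maps propagates along a horizontal segment. -/
theorem eq_of_segment_of_eventuallyEq {f g : ℂ → Y} {U : Set ℂ} (hU : IsOpen U)
    (hf : MDifferentiableOn 𝓘(ℂ, ℂ) 𝓘(ℂ, F) f U) (hg : MDifferentiableOn 𝓘(ℂ, ℂ) 𝓘(ℂ, F) g U)
    {w : ℂ} {T : ℝ} (hT : 0 ≤ T) (hseg : ∀ τ : ℝ, 0 ≤ τ → τ ≤ T → w - τ ∈ U)
    (hev : f =ᶠ[nhds (w - T)] g) : f w = g w := by
  have hw : w ∈ U := by simpa using hseg 0 le_rfl hT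
  set S : Set ℂ := (fun τ : ℝ => w - τ) '' Icc 0 T
  have hS : IsPreconnected S := isPreconnected_Icc.image _ (by fun_prop)
  have hSU : S ⊆ U := by
    rintro _ ⟨τ, hτ, rfl⟩
    exact hseg τ hτ.1 hτ.2
  have hwS : w ∈ S := ⟨0, left_mem_Icc.2 hT, by simp⟩
  have hsub := hS.subset_connectedComponentIn hwS hSU
  have hCU := connectedComponentIn_subset U w
  exact MDifferentiableOn.eqOn_of_preconnected_of_eventuallyEq (hU.connectedComponentIn)
    isPreconnected_connectedComponentIn (hf.mono hCU) (hg.mono hCU)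
    (hsub ⟨T, right_mem_Icc.2 hT, rfl⟩) hev (mem_connectedComponentIn hw)

/-- A Hartogs figure adapted to the paraboloid `{re w < c ‖z‖²}` shows that `f ∘ Ψ` extends
continuously to the boundary point, in the `q + 1` variables of `Ψ`. -/
theorem IsAdapted.exists_continuousAt_extension {q : ℕ} (hY : IsHartogs F q Y) {u : E → ℝ} {a : E}
    {η : ℝ} {n : E} {Ψ : (Fin q → ℂ) × ℂ → E} {c : ℝ} (h : IsAdapted u a η n Ψ c) {f : E → Y}
    (hf : MDifferentiableOn 𝓘(ℂ, E) 𝓘(ℂ, F) f {x ∈ Metric.ball a η | u x < 0}) :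
    ∃ g : (Fin q → ℂ) × ℂ → Y, ContinuousAt g 0 ∧
      ∀ᶠ p in nhds 0, Ψ p ∈ {x ∈ Metric.ball a η | u x < 0} → g p = f (Ψ p) := by
  set D := {x ∈ Metric.ball a η | u x < 0}
  have hD : IsOpen D := h.isOpen
  have hc := h.pos
  obtain ⟨ε, hε, hscale⟩ := h.scale c (c / 8) hc (by positivity)
  replace hscale := hscale ε hε le_rfl
  have hεc : (ε : ℂ) ≠ 0 := by exact_mod_cast hε.ne'
  have hcc : (c : ℂ) ≠ 0 := by exact_mod_cast hc.ne'
  -- the polydisc of the figure is `{|w + 3c/8| < c/2}` in the last variable: it contains the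
  -- boundary point, while the two parts of the figure stay inside the paraboloid
  let ℓ : ℂ → ℂ := fun w => -(3 * c / 8) + c / 2 * w
  let S : (Fin q → ℂ) × ℂ → E := fun p => Ψ ((ε : ℂ) • p.1, (ε : ℂ) ^ 2 * ℓ p.2)
  have hℓnorm : ∀ w : ℂ, ‖w‖ < 1 → ‖ℓ w‖ ≤ c := by
    intro w hw
    have h1 : ‖(-(3 * c / 8) : ℂ)‖ = 3 * c / 8 := by
      rw [norm_neg, show (3 * c / 8 : ℂ) = ((3 * c / 8 : ℝ) : ℂ) by push_cast; ring,
        Complex.norm_real, Real.norm_of_nonneg (by positivity)]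
    have h2 : ‖(c / 2 * w : ℂ)‖ = c / 2 * ‖w‖ := by
      rw [norm_mul, show (c / 2 : ℂ) = ((c / 2 : ℝ) : ℂ) by push_cast; ring,
        Complex.norm_real, Real.norm_of_nonneg (by positivity)]
    have := norm_add_le (-(3 * c / 8) : ℂ) (c / 2 * w)
    rw [h1, h2] at this
    simp only [ℓ]
    nlinarith
  have hℓre : ∀ w : ℂ, (ℓ w).re = -(3 * c / 8) + c / 2 * w.re := by
    intro w
    have : ℓ w = ((-(3 * c / 8) : ℝ) : ℂ) + ((c / 2 : ℝ) : ℂ) * w := by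
      simp only [ℓ]; push_cast; ring
    rw [this, Complex.add_re, Complex.re_ofReal_mul, Complex.ofReal_re]
  have hSdiff : Differentiable ℂ S := h.differentiable.comp (by fun_prop)
  have hnorm : ∀ z ∈ polydisc q 1, ‖z‖ ≤ 1 := fun z hz =>
    (pi_norm_le_iff_of_nonneg zero_le_one).2 fun i => (hz i).le
  have hSball : ∀ z ∈ polydisc q 1, ∀ w : ℂ, ‖w‖ < 1 → S (z, w) ∈ Metric.ball a η :=
    fun z hz w hw => (hscale z (hnorm z hz) _ (hℓnorm w hw)).1
  have hSfig : ∀ p ∈ hartogsFigure q (1 / 2), S p ∈ D := by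
    rintro ⟨z, w⟩ (⟨hz, hw⟩ | ⟨⟨hz, hz'⟩, hw⟩) <;> simp only [mem_ball_zero_iff] at hz hw
    · have hw1 : ‖w‖ < 1 := by linarith
      refine ⟨hSball z hz w hw1, (hscale z (hnorm z hz) _ (hℓnorm w hw1)).2 ?_⟩
      have h1 := Complex.re_le_norm w
      have h2 : 0 ≤ c * ‖z‖ ^ 2 := by positivity
      rw [hℓre]
      nlinarith
    · refine ⟨hSball z hz w hw, (hscale z (hnorm z hz) _ (hℓnorm w hw)).2 ?_⟩
      have h1 := Complex.re_le_norm w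
      have h2 : 1 / 2 ≤ ‖z‖ := by
        by_contra! hlt
        refine hz' fun i => ?_
        have := norm_le_pi_norm z i
        linarith
      have h3 : c * (1 / 2) ^ 2 ≤ c * ‖z‖ ^ 2 := by gcongr
      rw [hℓre]
      nlinarith
  obtain ⟨g, hg, hgf⟩ := hY (1 / 2) (by norm_num) (by norm_num) (f ∘ S)
    (hf.comp hSdiff.mdifferentiable.mdifferentiableOn hSfig)
  have hPopen : IsOpen (unitPolydisc q) := by
    refine IsOpen.prod ?_ Metric.isOpen_ball
    simp only [polydisc, ofPred_forall]
    exact isOpen_iInter_of_finite fun i => isOpen_lt (by fun_prop) continuous_const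
  let T : (Fin q → ℂ) × ℂ → (Fin q → ℂ) × ℂ := fun p =>
    ((ε : ℂ)⁻¹ • p.1, (p.2 / (ε : ℂ) ^ 2 + 3 * c / 8) / (c / 2))
  have hTc : Continuous T := by fun_prop
  have hST : ∀ p, S (T p) = Ψ p := by
    intro p
    simp only [S, T, ℓ]
    congr 1
    refine Prod.ext (smul_inv_smul₀ hεc _) ?_
    field_simp
    ring
  have hT0 : T 0 = (0, ((3 / 4 : ℝ) : ℂ)) := by
    simp only [T, Prod.fst_zero, Prod.snd_zero, smul_zero, zero_div, zero_add]
    congr 1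
    push_cast
    field_simp
    norm_num
  have hT0mem : T 0 ∈ unitPolydisc q := by
    rw [hT0]
    refine ⟨fun i => by simp, ?_⟩
    rw [mem_ball_zero_iff, Complex.norm_real]
    norm_num [abs_of_pos]
  refine ⟨g ∘ T, ?_, ?_⟩
  · exact ContinuousAt.comp (hg.continuousOn.continuousAt (hPopen.mem_nhds hT0mem))
      hTc.continuousAt
  · have hnear : ∀ᶠ p in nhds (0 : (Fin q → ℂ) × ℂ),
        T p ∈ unitPolydisc q ∧ ‖(T p).2 - ((3 / 4 : ℝ) : ℂ)‖ < 1 / 8 := by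
      refine (hTc.continuousAt.eventually (hPopen.eventually_mem hT0mem)).and ?_
      have : Continuous fun p => ‖(T p).2 - ((3 / 4 : ℝ) : ℂ)‖ := by fun_prop
      refine this.continuousAt.eventually_lt_const ?_
      simp [hT0]
    filter_upwards [hnear] with p hp hpD
    rw [← hST p] at hpD ⊢
    simp only [Function.comp]
    generalize T p = t at hp hpD
    obtain ⟨z, w⟩ := t
    obtain ⟨⟨hz, hw⟩, hw34⟩ := hp
    simp only [mem_ball_zero_iff] at hz hw hw34
    set U := {v : ℂ | v ∈ Metric.ball (0 : ℂ) 1 ∧ S (z, v) ∈ D}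
    have hpair : Differentiable ℂ fun v : ℂ => (z, v) := by fun_prop
    have hU : IsOpen U := Metric.isOpen_ball.inter
      (hD.preimage (hSdiff.continuous.comp hpair.continuous))
    have hend : ‖w - ((3 / 4 : ℝ) : ℂ)‖ < 1 / 2 := by linarith
    have hstep : ∀ (v : ℂ) (τ : ℝ),
        S (z, v - τ) = S (z, v) - ((ε ^ 2 * (c / 2) * τ : ℝ) : ℂ) • n := by
      intro v τ
      have := h.map_add ((ε : ℂ) • z) ((ε : ℂ) ^ 2 * ℓ v) (-((ε ^ 2 * (c / 2) * τ : ℝ) : ℂ))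
      rw [neg_smul, ← sub_eq_add_neg, ← sub_eq_add_neg] at this
      refine Eq.trans ?_ this
      simp only [S, ℓ]
      congr 2
      push_cast
      ring
    refine eq_of_segment_of_eventuallyEq (F := F) (f := fun v => g (z, v))
      (g := fun v => f (S (z, v))) hU ?_ ?_ (T := 3 / 4) (by norm_num) ?_ ?_
    · exact hg.comp hpair.mdifferentiable.mdifferentiableOn fun v hv => ⟨hz, hv.1⟩
    · exact hf.comp (hSdiff.comp hpair).mdifferentiable.mdifferentiableOn fun v hv => hv.2
    · intro τ h0 h1
      have hmem : ‖w - (τ : ℂ)‖ < 1 := by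
        have e : w - (τ : ℂ) = (w - ((3 / 4 : ℝ) : ℂ)) + ((3 / 4 - τ : ℝ) : ℂ) := by
          push_cast; ring
        rw [e]
        refine (norm_add_le _ _).trans_lt ?_
        rw [Complex.norm_real, Real.norm_of_nonneg (by linarith)]
        linarith
      refine ⟨by simpa using hmem, hSball z hz _ hmem, ?_⟩
      have hb := hSball z hz _ hmem
      rw [hstep] at hb ⊢
      exact h.descend _ hpD.1 _ (by positivity) hb hpD.2
    · have : Metric.ball (0 : ℂ) (1 / 2) ∈ nhds (w - ((3 / 4 : ℝ) : ℂ)) :=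
        Metric.isOpen_ball.mem_nhds (by simpa using hend)
      filter_upwards [this] with v hv
      exact hgf (Or.inl ⟨hz, hv⟩)

/-- The extension is the chart inverse of the averages of `f`, read in the chart at the limit value,
over translates of the circle bounding a small analytic disc tangent to the hypersurface. The circles
stay in `{u < 0}` while the discs pass through the boundary point. The continuity of `g` makes `f`
take values in a single chart there. -/
theorem IsAdapted.exists_local_extension {q : ℕ} (hq : 0 < q) {u : E → ℝ} {a : E}
    {η : ℝ} {n : E} {Ψ : (Fin q → ℂ) × ℂ → E} {c : ℝ} (h : IsAdapted u a η n Ψ c) {f : E → Y}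
    (hf : MDifferentiableOn 𝓘(ℂ, E) 𝓘(ℂ, F) f {x ∈ Metric.ball a η | u x < 0})
    {g : (Fin q → ℂ) × ℂ → Y} (hg : ContinuousAt g 0)
    (hgf : ∀ᶠ p in nhds 0, Ψ p ∈ {x ∈ Metric.ball a η | u x < 0} → g p = f (Ψ p)) :
    ∃ V : Set E, IsOpen V ∧ a ∈ V ∧ V ⊆ Metric.ball a η ∧ ∃ G : E → Y,
      MDifferentiableOn 𝓘(ℂ, E) 𝓘(ℂ, F) G V ∧ ∀ x ∈ V, u x < 0 → G x = f x := by
  have : IsManifold 𝓘(ℂ, F) 1 Y := .of_le (n := ω) (by simp)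
  set D := {x ∈ Metric.ball a η | u x < 0}
  have hD : IsOpen D := h.isOpen
  have hc := h.pos
  set φ := chartAt F (g 0)
  have hφ0 : g 0 ∈ φ.source := mem_chart_source F (g 0)
  obtain ⟨r, hr, hrt⟩ := Metric.nhds_basis_closedBall.mem_iff.1
    (φ.open_target.mem_nhds (φ.map_source hφ0))
  -- the points of `Y` that the chart sends to the ball of radius `r`
  set O := φ.source ∩ φ ⁻¹' Metric.ball (φ (g 0)) r
  have hO : IsOpen O := φ.isOpen_inter_preimage Metric.isOpen_ball
  have hgO : g 0 ∈ O := ⟨hφ0, Metric.mem_ball_self hr⟩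
  set N := D ∩ f ⁻¹' O
  have hN : IsOpen N := hf.continuousOn.isOpen_inter_preimage hD hO
  have hhol : DifferentiableOn ℂ (φ ∘ f) N := by
    intro x hx
    have h1 := (mdifferentiableAt_iff_target_of_mem_source hx.2.1).1
      (hf.mdifferentiableAt (hD.mem_nhds hx.1))
    exact (mdifferentiableAt_iff_differentiableAt.1 h1.2).differentiableWithinAt
  obtain ⟨ε₁, hε₁, hscale⟩ := h.scale 1 (min c 1) one_pos (by positivity)
  obtain ⟨ε₂, hε₂, hnear⟩ := Metric.eventually_nhds_iff_ball.1
    (hgf.and (hg.eventually (hO.eventually_mem hgO)))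
  set ε := min ε₁ (min 1 (ε₂ / 2))
  have hε : 0 < ε := by positivity
  have hεn : ‖(ε : ℂ)‖ = ε := by simp [abs_of_pos hε]
  have hle2 : ε ≤ 1 := (min_le_right _ _).trans (min_le_left _ _)
  have hle3 : ε ≤ ε₂ / 2 := (min_le_right _ _).trans (min_le_right _ _)
  replace hscale := hscale ε hε (min_le_left _ _)
  let e₁ : Fin q → ℂ := Pi.single ⟨0, hq⟩ 1
  have he₁ : ‖e₁‖ = 1 := by simp only [e₁, Pi.norm_single, norm_one]
  set γ : ℂ → E := fun ζ => Ψ ((ε : ℂ) • (ζ • e₁), 0) - a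
  have hγ : Differentiable ℂ γ :=
    (h.differentiable.comp (by fun_prop)).sub_const a
  have hγ0 : γ 0 = 0 := by
    have : (((ε : ℂ) • ((0 : ℂ) • e₁), 0) : (Fin q → ℂ) × ℂ) = 0 := by simp
    simp only [γ, this, h.map_zero, sub_self]
  -- the point of the normal segment at height `s`
  let σ : ℝ → E := fun s => a - ((ε ^ 2 * s : ℝ) : ℂ) • n
  have hσ : Continuous σ := by fun_prop
  have hσγ : ∀ s ζ, σ s + γ ζ = Ψ ((ε : ℂ) • (ζ • e₁), (ε : ℂ) ^ 2 * (-s : ℂ)) := by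
    intro s ζ
    have := h.map_add ((ε : ℂ) • (ζ • e₁)) 0 ((ε : ℂ) ^ 2 * (-s : ℂ))
    rw [zero_add] at this
    rw [this]
    simp only [σ, γ]
    rw [show ((ε : ℂ) ^ 2 * (-s : ℂ)) = -((ε ^ 2 * s : ℝ) : ℂ) by push_cast; ring, neg_smul]
    abel
  have hnormζ : ∀ ζ : ℂ, ‖ζ • e₁‖ = ‖ζ‖ := fun ζ => by rw [norm_smul, he₁, mul_one]
  have hs1 : ∀ s ∈ Icc (0 : ℝ) 1, ‖(-s : ℂ)‖ ≤ 1 := by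
    intro s hs
    rw [norm_neg, Complex.norm_real, Real.norm_of_nonneg hs.1]
    exact hs.2
  have hσball : ∀ s ∈ Icc (0 : ℝ) 1, σ s ∈ Metric.ball a η := by
    intro s hs
    have := (hscale ((0 : ℂ) • e₁) (by rw [hnormζ]; simp) (-s : ℂ) (hs1 s hs)).1
    rwa [← hσγ, hγ0, add_zero] at this
  have hN' : ∀ s ∈ Icc (0 : ℝ) 1, ∀ ζ : ℂ, ‖ζ‖ ≤ 1 → -s - c * ‖ζ‖ ^ 2 ≤ -min c 1 →
      σ s + γ ζ ∈ N := by
    intro s hs ζ hζ hle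
    have hb : ((ε : ℂ) • (ζ • e₁), (ε : ℂ) ^ 2 * (-s : ℂ)) ∈
        Metric.ball (0 : (Fin q → ℂ) × ℂ) ε₂ := by
      rw [mem_ball_zero_iff, Prod.norm_def, max_lt_iff]
      have h1 : ε * ‖ζ‖ ≤ ε * 1 := by gcongr
      have h2 : ε ^ 2 * ‖(-s : ℂ)‖ ≤ (ε * 1) * 1 := by
        rw [sq]
        have := hs1 s hs
        gcongr
      constructor
      · rw [norm_smul, hnormζ, hεn]
        linarith
      · rw [norm_mul, norm_pow, hεn]
        linarith
    have hmemD : σ s + γ ζ ∈ D := by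
      have := hscale (ζ • e₁) (by rwa [hnormζ]) (-s : ℂ) (hs1 s hs)
      rw [← hσγ, hnormζ] at this
      exact ⟨this.1, this.2 (by simpa using hle)⟩
    refine ⟨hmemD, ?_⟩
    have hval := (hnear _ hb).1 (by rw [← hσγ]; exact hmemD)
    rw [← hσγ] at hval
    rw [mem_preimage, ← hval]
    exact (hnear _ hb).2
  have hcircle : ∀ s ∈ Icc (0 : ℝ) 1, ∀ ζ : ℂ, ‖ζ‖ = 1 → σ s + γ ζ ∈ N := by
    intro s hs ζ hζ
    refine hN' s hs ζ hζ.le ?_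
    rw [hζ]
    have := min_le_left c 1
    linarith [hs.1]
  have hdisc : ∀ ζ : ℂ, ‖ζ‖ ≤ 1 → σ 1 + γ ζ ∈ N := by
    intro ζ hζ
    refine hN' 1 (by simp) ζ hζ ?_
    have := min_le_right c 1
    have : 0 ≤ c * ‖ζ‖ ^ 2 := by positivity
    linarith
  obtain ⟨δ, hδ, hcircleδ, hdiscδ⟩ : ∃ δ > 0,
      (∀ x, ∀ s ∈ Icc (0 : ℝ) 1, dist x (σ s) < δ → ∀ ζ : ℂ, ‖ζ‖ = 1 → x + γ ζ ∈ N) ∧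
      (∀ x, dist x (σ 1) < δ → ∀ ζ : ℂ, ‖ζ‖ ≤ 1 → x + γ ζ ∈ N) := by
    have hcont : Continuous fun p : ℝ × ℂ => σ p.1 + γ p.2 :=
      (hσ.comp continuous_fst).add (hγ.continuous.comp continuous_snd)
    set K₁ := (fun p : ℝ × ℂ => σ p.1 + γ p.2) '' (Icc 0 1 ×ˢ Metric.sphere 0 1)
    set K₂ := (fun p : ℝ × ℂ => σ p.1 + γ p.2) '' ({1} ×ˢ Metric.closedBall 0 1)
    have hK : IsCompact (K₁ ∪ K₂) :=
      ((isCompact_Icc.prod (isCompact_sphere 0 1)).image hcont).union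
        ((isCompact_singleton.prod (isCompact_closedBall 0 1)).image hcont)
    have hKN : K₁ ∪ K₂ ⊆ N := by
      rintro _ (⟨⟨s, ζ⟩, ⟨hs, hζ⟩, rfl⟩ | ⟨⟨s, ζ⟩, ⟨rfl, hζ⟩, rfl⟩)
      · exact hcircle s hs ζ (by simpa using hζ)
      · exact hdisc ζ (by simpa using hζ)
    obtain ⟨δ, hδ, hsub⟩ := hK.exists_thickening_subset_open hN hKN
    refine ⟨δ, hδ, fun x s hs hx ζ hζ => hsub ?_, fun x hx ζ hζ => hsub ?_⟩
    · exact Metric.mem_thickening_iff.2 ⟨σ s + γ ζ,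
        Or.inl ⟨(s, ζ), ⟨hs, by simpa using hζ⟩, rfl⟩, by simpa using hx⟩
    · exact Metric.mem_thickening_iff.2 ⟨σ 1 + γ ζ,
        Or.inr ⟨(1, ζ), ⟨rfl, by simpa using hζ⟩, rfl⟩, by simpa using hx⟩
  set V := Metric.thickening δ (σ '' Icc 0 1) ∩ Metric.ball a η
  have hV : IsOpen V := Metric.isOpen_thickening.inter Metric.isOpen_ball
  have hVcircle : ∀ x ∈ V, ∀ ζ : ℂ, ‖ζ‖ = 1 → x + γ ζ ∈ N := by
    rintro x ⟨hx, -⟩ ζ hζ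
    obtain ⟨_, ⟨s, hs, rfl⟩, hxs⟩ := Metric.mem_thickening_iff.1 hx
    exact hcircleδ x s hs hxs ζ hζ
  set A : E → F := fun x => Real.circleAverage (fun ζ => (φ ∘ f) (x + γ ζ)) 0 1
  have hA : DifferentiableOn ℂ A V :=
    hhol.circleAverage_comp_add hN hγ.continuous hV hVcircle
  have hAt : ∀ x ∈ V, A x ∈ φ.target := by
    intro x hx
    refine hrt ?_
    rw [Metric.mem_closedBall, dist_eq_norm]
    refine norm_circleAverage_sub_le ?_ fun ζ hζ => ?_
    · exact hhol.continuousOn.comp (continuous_const.add hγ.continuous).continuousOn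
        fun ζ hζ => hVcircle x hx ζ (by simpa using hζ)
    · have := (hVcircle x hx ζ hζ).2.2
      rw [mem_preimage, Metric.mem_ball, dist_eq_norm] at this
      exact this.le
  have hG : MDifferentiableOn 𝓘(ℂ, E) 𝓘(ℂ, F) (φ.symm ∘ A) V :=
    (mdifferentiableOn_atlas_symm (chart_mem_atlas F (g 0))).comp hA.mdifferentiableOn hAt
  -- the mean value property
  have hGf : ∀ x, dist x (σ 1) < δ → φ.symm (A x) = f x := by
    intro x hx
    have hx0 : x ∈ N := by simpa [hγ0] using hdiscδ x hx 0 (by simp)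
    have hd : DiffContOnCl ℂ (fun ζ => (φ ∘ f) (x + γ ζ)) (Metric.ball 0 |1|) := by
      refine DifferentiableOn.diffContOnCl ?_
      rw [abs_one, closure_ball _ one_ne_zero]
      exact hhol.comp (hγ.const_add x).differentiableOn
        fun ζ hζ => hdiscδ x hx ζ (by simpa using hζ)
    have hAx : A x = φ (f x) := by
      have := hd.circleAverage
      simp only [hγ0, add_zero] at this
      exact this
    rw [hAx, φ.left_inv hx0.2.1]
  refine ⟨V, hV, ⟨?_, ?_⟩, inter_subset_right, φ.symm ∘ A, hG, ?_⟩
  · exact Metric.self_subset_thickening hδ _ ⟨0, by simp, by simp [σ]⟩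
  · have := hσball 0 (by simp)
    simpa [σ] using this
  · rintro x ⟨hx, hxb⟩ hux
    obtain ⟨_, ⟨s, hs, rfl⟩, hxs⟩ := Metric.mem_thickening_iff.1 hx
    have hline : Differentiable ℂ fun w : ℂ => x + w • n := by fun_prop
    set U := (fun w : ℂ => x + w • n) ⁻¹' (V ∩ D)
    have hU : IsOpen U := (hV.inter hD).preimage hline.continuous
    have hend : dist (x + (0 - ((ε ^ 2 * (1 - s) : ℝ) : ℂ)) • n) (σ 1) < δ := by
      rw [dist_eq_norm] at hxs ⊢
      convert hxs using 2
      simp only [σ]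
      push_cast
      module
    have key := eq_of_segment_of_eventuallyEq (F := F) (f := fun w : ℂ => (φ.symm ∘ A) (x + w • n))
      (g := fun w => f (x + w • n)) hU
      (hG.comp hline.mdifferentiable.mdifferentiableOn fun w hw => hw.1)
      (hf.comp hline.mdifferentiable.mdifferentiableOn fun w hw => hw.2)
      (w := 0) (T := ε ^ 2 * (1 - s)) (mul_nonneg (by positivity) (by linarith [hs.2])) ?_ ?_
    · simpa using key
    · intro τ h0 h1
      have hxτ : dist (x + (0 - (τ : ℂ)) • n) (σ (s + τ / ε ^ 2)) < δ := by
        rw [dist_eq_norm] at hxs ⊢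
        convert hxs using 2
        simp only [σ]
        rw [mul_add, mul_div_cancel₀ _ (by positivity)]
        push_cast
        module
      have hs' : s + τ / ε ^ 2 ∈ Icc (0 : ℝ) 1 := by
        refine ⟨add_nonneg hs.1 (by positivity), ?_⟩
        have : τ / ε ^ 2 ≤ 1 - s := (div_le_iff₀' (by positivity)).2 h1
        linarith
      have hball : x - τ • n ∈ Metric.ball a η := by
        refine (convex_ball a η).sub_smul_mem_of_mem_Icc hxb ?_ ⟨h0, h1⟩
        have := hdiscδ _ hend 0 (by simp)
        rw [hγ0, add_zero, zero_sub, neg_smul, ← sub_eq_add_neg, Complex.coe_smul] at this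
        exact this.1.1
      have e : x + (0 - (τ : ℂ)) • n = x - (τ : ℂ) • n := by module
      rw [← Complex.coe_smul] at hball
      rw [e] at hxτ
      simp only [U, mem_preimage, e]
      exact ⟨⟨Metric.mem_thickening_iff.2 ⟨_, ⟨_, hs', rfl⟩, hxτ⟩, hball⟩, hball,
        h.descend x hxb τ h0 hball hux⟩
    · have hcontd : Continuous fun w : ℂ => dist (x + w • n) (σ 1) := by fun_prop
      filter_upwards [hcontd.continuousAt.eventually_lt_const hend] with w hw
      exact hGf _ hw

end LocalExtension

end HartogsHilbert

/-! ### The case `q = 0` and the passage to manifolds -/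

namespace HartogsHilbert

section Manifolds

variable {E : Type*} [NormedAddCommGroup E] [NormedSpace ℂ E]
  {X : Type*} [TopologicalSpace X] [ChartedSpace E X]
  {F : Type*} [NormedAddCommGroup F] [NormedSpace ℂ F]
  {Y : Type*} [TopologicalSpace Y] [T2Space Y] [ChartedSpace F Y] [IsManifold 𝓘(ℂ, F) ω Y]

/-- No nonempty manifold of positive dimension is `0`-Hartogs: the figure is a disc, and a branch of
a square root in a chart has no holomorphic extension across its branch point on the circle. -/
theorem not_isHartogs_zero [Nontrivial F] (y : Y) : ¬ IsHartogs F 0 Y := by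
  intro hY
  have : IsManifold 𝓘(ℂ, F) 1 Y := .of_le (n := ω) (by simp)
  set φ := chartAt F y
  have hφy : y ∈ φ.source := mem_chart_source F y
  obtain ⟨R, hR, hRt⟩ := Metric.isOpen_iff.1 φ.open_target _ (φ.map_source hφy)
  obtain ⟨e, he0, heR⟩ : ∃ e : F, 0 < ‖e‖ ∧ ‖e‖ < R / 2 := by
    obtain ⟨v, hv⟩ := exists_ne (0 : F)
    have hv' : 0 < ‖v‖ := norm_pos_iff.2 hv
    refine ⟨((R / 4 / ‖v‖ : ℝ) : ℂ) • v, ?_⟩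
    rw [norm_smul, Complex.norm_real, Real.norm_of_nonneg (by positivity),
      div_mul_cancel₀ _ hv'.ne']
    constructor <;> linarith
  let s : ℂ → ℂ := fun w => (1 - 2 * w) ^ (((2 : ℕ) : ℂ)⁻¹)
  have hs2 : ∀ w, s w ^ 2 = 1 - 2 * w := fun w => Complex.cpow_nat_inv_pow _ two_ne_zero
  have hsd : DifferentiableOn ℂ s (Metric.ball 0 (1 / 2)) := by
    intro w hw
    rw [mem_ball_zero_iff] at hw
    have hre : 0 < (1 - 2 * w).re := by
      have := Complex.re_le_norm w
      simp
      linarith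
    have hlin : DifferentiableAt ℂ (fun w : ℂ => 1 - 2 * w) w := by fun_prop
    exact (hlin.cpow (differentiableAt_const _)
      (Complex.mem_slitPlane_iff.2 (Or.inl hre))).differentiableWithinAt
  have hst : ∀ w : ℂ, ‖w‖ < 1 / 2 → φ y + s w • e ∈ φ.target := by
    intro w hw
    refine hRt ?_
    have h1 : ‖s w‖ ^ 2 ≤ 2 := by
      rw [← norm_pow, hs2]
      refine (norm_sub_le _ _).trans ?_
      rw [norm_one, norm_mul, Complex.norm_ofNat]
      linarith
    have h2 : ‖s w‖ ≤ 2 := by nlinarith [norm_nonneg (s w)]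
    rw [Metric.mem_ball, dist_eq_norm, add_sub_cancel_left, norm_smul]
    nlinarith
  have hfig : ∀ p ∈ hartogsFigure 0 (1 / 2), ‖p.2‖ < 1 / 2 := by
    rintro p (hp | hp)
    · simpa using hp.2
    · exact absurd (fun i => i.elim0) hp.1.2
  obtain ⟨g, hg, hgf⟩ := hY (1 / 2) (by norm_num) (by norm_num)
    (fun p => φ.symm (φ y + s p.2 • e)) (by
      refine (mdifferentiableOn_atlas_symm (I := 𝓘(ℂ, F)) (chart_mem_atlas F y)).comp
        (DifferentiableOn.mdifferentiableOn ?_) fun p hp => hst _ (hfig p hp)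
      have : DifferentiableOn ℂ (fun p : (Fin 0 → ℂ) × ℂ => s p.2) (hartogsFigure 0 (1 / 2)) :=
        hsd.comp differentiable_snd.differentiableOn fun p hp => by simpa using hfig p hp
      exact (this.smul_const e).const_add _)
  have hk : MDifferentiableOn 𝓘(ℂ, ℂ) 𝓘(ℂ, F) (fun w : ℂ => g (0, w)) (Metric.ball 0 1) := by
    have hp : Differentiable ℂ fun w : ℂ => ((0 : Fin 0 → ℂ), w) := by fun_prop
    exact hg.comp hp.mdifferentiable.mdifferentiableOn fun w hw => ⟨fun i => i.elim0, hw⟩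
  have hhalf : (((1 / 2 : ℝ) : ℂ)) ∈ Metric.ball (0 : ℂ) 1 := by
    rw [mem_ball_zero_iff, Complex.norm_real]
    norm_num [abs_of_pos]
  have hkd := hk.mdifferentiableAt (Metric.isOpen_ball.mem_nhds hhalf)
  have hval : ∀ᶠ t : ℝ in nhdsWithin (1 / 2) (Iio (1 / 2)),
      g (0, (t : ℂ)) = φ.symm (φ y + s t • e) ∧ ‖(t : ℂ)‖ < 1 / 2 := by
    have : Ioo (0 : ℝ) (1 / 2) ∈ nhdsWithin (1 / 2) (Iio (1 / 2)) :=
      Ioo_mem_nhdsLT (by norm_num)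
    filter_upwards [this] with t ht
    have ht' : ‖(t : ℂ)‖ < 1 / 2 := by
      rw [Complex.norm_real, Real.norm_of_nonneg ht.1.le]
      exact ht.2
    exact ⟨hgf (Or.inl ⟨fun i => i.elim0, by simpa using ht'⟩), ht'⟩
  have hofReal : Filter.Tendsto (fun t : ℝ => (t : ℂ)) (nhdsWithin (1 / 2) (Iio (1 / 2)))
      (nhds ((1 / 2 : ℝ) : ℂ)) :=
    (Complex.continuous_ofReal.tendsto _).mono_left nhdsWithin_le_nhds
  have hnorms : ∀ t : ℝ, t < 1 / 2 → ‖s t‖ ^ 2 = 1 - 2 * t := by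
    intro t ht
    rw [← norm_pow, hs2, show (1 - 2 * t : ℂ) = ((1 - 2 * t : ℝ) : ℂ) by push_cast; ring,
      Complex.norm_real, Real.norm_of_nonneg (by linarith)]
  have hs0 : Filter.Tendsto (fun t : ℝ => s t) (nhdsWithin (1 / 2) (Iio (1 / 2))) (nhds 0) := by
    have hsqrt : Filter.Tendsto (fun t : ℝ => √(1 - 2 * t)) (nhdsWithin (1 / 2) (Iio (1 / 2)))
        (nhds 0) := by
      have : ContinuousAt (fun t : ℝ => √(1 - 2 * t)) (1 / 2) := by fun_prop
      simpa [ContinuousAt] using this.tendsto.mono_left nhdsWithin_le_nhds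
    refine squeeze_zero_norm' ?_ hsqrt
    filter_upwards [self_mem_nhdsWithin] with t ht
    exact Real.le_sqrt_of_sq_le (hnorms t ht).le
  have hlim : g (0, ((1 / 2 : ℝ) : ℂ)) = y := by
    have h1 : Filter.Tendsto (fun t : ℝ => g (0, (t : ℂ))) (nhdsWithin (1 / 2) (Iio (1 / 2)))
        (nhds (g (0, ((1 / 2 : ℝ) : ℂ)))) := hkd.continuousAt.tendsto.comp hofReal
    have h2 : Filter.Tendsto (fun t : ℝ => φ.symm (φ y + s t • e))
        (nhdsWithin (1 / 2) (Iio (1 / 2))) (nhds y) := by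
      have h3 : Filter.Tendsto (fun t : ℝ => φ y + s t • e) (nhdsWithin (1 / 2) (Iio (1 / 2)))
          (nhds (φ y)) := by
        simpa using (hs0.smul_const e).const_add (φ y)
      have h4 := (φ.continuousAt_symm (φ.map_source hφy)).tendsto.comp h3
      rwa [φ.left_inv hφy] at h4
    exact tendsto_nhds_unique h1 (h2.congr' (hval.mono fun t ht => ht.1.symm))
  have hd : DifferentiableAt ℂ (fun w : ℂ => φ (g (0, w))) ((1 / 2 : ℝ) : ℂ) :=
    mdifferentiableAt_iff_differentiableAt.1
      ((mdifferentiableAt_iff_target_of_mem_source (y := y) (by simpa only [hlim] using hφy)).1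
        hkd).2
  obtain ⟨C, hC⟩ := hd.isBigO_sub.bound
  -- differentiability forces `√(1 - 2t) ‖e‖ ≤ C (1/2 - t)`, which fails as `t → 1/2`
  have hbound : ∀ᶠ t : ℝ in nhdsWithin (1 / 2) (Iio (1 / 2)),
      2 * ‖e‖ ^ 2 ≤ C ^ 2 * (1 / 2 - t) := by
    filter_upwards [hofReal.eventually hC, hval, self_mem_nhdsWithin] with t ht hv hlt
    rw [hlim, hv.1, φ.right_inv (hst _ hv.2), add_sub_cancel_left, norm_smul,
      ← Complex.ofReal_sub, Complex.norm_real, Real.norm_eq_abs, abs_sub_comm,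
      abs_of_pos (sub_pos.2 hlt)] at ht
    have h1 : (‖s t‖ * ‖e‖) ^ 2 ≤ (C * (1 / 2 - t)) ^ 2 := by gcongr
    rw [mul_pow, hnorms t hlt] at h1
    have h2 : (0 : ℝ) < 1 / 2 - t := sub_pos.2 hlt
    refine le_of_mul_le_mul_right ?_ h2
    linarith
  have hle : 2 * ‖e‖ ^ 2 ≤ 0 := by
    have : Filter.Tendsto (fun t : ℝ => C ^ 2 * (1 / 2 - t)) (nhdsWithin (1 / 2) (Iio (1 / 2)))
        (nhds 0) := by
      have : ContinuousAt (fun t : ℝ => C ^ 2 * (1 / 2 - t)) (1 / 2) := by fun_prop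
      simpa [ContinuousAt] using this.tendsto.mono_left nhdsWithin_le_nhds
    exact ge_of_tendsto this hbound
  have : 0 < ‖e‖ ^ 2 := by positivity
  linarith

/-- The chart at a boundary point reads a local defining function as a `C²` function with a
nonvanishing derivative. -/
theorem IsLocalDefiningFunction.chart_properties {D U : Set X} {ρ : X → ℝ} {p : X}
    (h : IsLocalDefiningFunction E D U ρ p) (hD : IsOpen D) (hp : p ∈ frontier D) :
    ContDiffAt ℝ 2 (ρ ∘ (chartAt E p).symm) (chartAt E p p) ∧
      (ρ ∘ (chartAt E p).symm) (chartAt E p p) = 0 ∧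
      fderiv ℝ (ρ ∘ (chartAt E p).symm) (chartAt E p p) ≠ 0 := by
  have hC : ContMDiffAt 𝓘(ℝ, E) 𝓘(ℝ, ℝ) 2 ρ p := h.contMDiffOn.contMDiffAt (h.isOpen.mem_nhds h.mem)
  refine ⟨?_, ?_, ?_⟩
  · have := (contMDiffAt_iff.1 hC).2
    simp only [mfld_simps, contDiffWithinAt_univ] at this
    exact this
  · have hinv : (chartAt E p).symm (chartAt E p p) = p :=
      (chartAt E p).left_inv (mem_chart_source E p)
    simp only [Function.comp, hinv]
    apply le_antisymm
    · refine le_of_not_gt fun hpos => ?_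
      obtain ⟨x, ⟨hxρ, hxU⟩, hxD⟩ := mem_closure_iff_nhds.1 hp.1 _
        (Filter.inter_mem (hC.continuousAt.eventually_const_lt hpos) (h.isOpen.mem_nhds h.mem))
      have hx : x ∈ {x ∈ U | ρ x < 0} := h.inter_eq ▸ (⟨hxD, hxU⟩ : x ∈ D ∩ U)
      exact lt_asymm hx.2 hxρ
    · refine le_of_not_gt fun hneg => ?_
      have : p ∈ D ∩ U := h.inter_eq ▸ (⟨h.mem, hneg⟩ : p ∈ {x ∈ U | ρ x < 0})
      exact hp.2 (hD.interior_eq.symm ▸ this.1)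
  · have hne := h.mfderiv_ne_zero p ⟨hp, h.mem⟩
    have hmd : MDifferentiableAt 𝓘(ℝ, E) 𝓘(ℝ, ℝ) ρ p := hC.mdifferentiableAt (by norm_num)
    intro h0
    apply hne
    rw [hmd.mfderiv]
    simp only [mfld_simps, writtenInExtChartAt, fderivWithin_univ]
    exact h0

theorem exists_extension_of_isPseudoconcaveAt [IsManifold 𝓘(ℂ, E) ω X] [CompleteSpace F]
    [Nontrivial F] {q : ℕ} (hY : IsHartogs F q Y) {D : Set X} (hD : IsOpen D) {p : X}
    (hp : IsPseudoconcaveAt E q D p) {f : X → Y} (hf : MDifferentiableOn 𝓘(ℂ, E) 𝓘(ℂ, F) f D) :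
    ∃ V : Set X, IsOpen V ∧ p ∈ V ∧ ∃ g : X → Y,
      MDifferentiableOn 𝓘(ℂ, E) 𝓘(ℂ, F) g (D ∪ V) ∧ EqOn g f D := by
  have : IsManifold 𝓘(ℂ, E) 1 X := .of_le (n := ω) (by simp)
  rcases q.eq_zero_or_pos with rfl | hq
  · exact absurd hY (not_isHartogs_zero (f p))
  obtain ⟨hpD, U, ρ, hρ, W, hW, hWt, hneg⟩ := hp
  obtain ⟨hu, h0, hl⟩ := hρ.chart_properties hD hpD
  set φ := chartAt E p
  have hps : p ∈ φ.source := mem_chart_source E p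
  set u : E → ℝ := ρ ∘ φ.symm
  have hO : φ.target ∩ φ.symm ⁻¹' U ∈ nhds (φ p) :=
    (φ.isOpen_inter_preimage_symm hρ.isOpen).mem_nhds
      ⟨φ.map_source hps, by simpa [φ.left_inv hps] using hρ.mem⟩
  obtain ⟨η, n, Ψ, c, -, hball, had⟩ := exists_isAdapted hq hu h0 hl hW hWt hneg hO
  have hmaps : ∀ x ∈ {x ∈ Metric.ball (φ p) η | u x < 0}, φ.symm x ∈ D := fun x hx =>
    (hρ.inter_eq ▸ (⟨(hball hx.1).2, hx.2⟩ : φ.symm x ∈ {x ∈ U | ρ x < 0}) :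
      φ.symm x ∈ D ∩ U).1
  have hf' : MDifferentiableOn 𝓘(ℂ, E) 𝓘(ℂ, F) (f ∘ φ.symm)
      {x ∈ Metric.ball (φ p) η | u x < 0} :=
    hf.comp ((mdifferentiableOn_atlas_symm (chart_mem_atlas E p)).mono
      fun x hx => (hball hx.1).1) hmaps
  obtain ⟨g₀, hg₀, hg₀f⟩ := had.exists_continuousAt_extension hY hf'
  obtain ⟨V, hV, haV, hVball, G, hG, hGf⟩ := had.exists_local_extension hq hf' hg₀ hg₀f
  set V' := φ.source ∩ φ ⁻¹' V
  have hV' : IsOpen V' := φ.isOpen_inter_preimage hV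
  classical
  have hGV : MDifferentiableOn 𝓘(ℂ, E) 𝓘(ℂ, F) (G ∘ φ) V' :=
    hG.comp ((mdifferentiableOn_atlas (chart_mem_atlas E p)).mono inter_subset_left)
      fun x hx => hx.2
  set g : X → Y := fun x => if x ∈ V' then G (φ x) else f x
  have hgV : EqOn g (G ∘ φ) V' := fun x hx => if_pos hx
  have hgD : EqOn g f D := by
    intro x hx
    by_cases hxV : x ∈ V'
    · have hxU : x ∈ U := by
        have := (hball (hVball hxV.2)).2
        rwa [mem_preimage, φ.left_inv hxV.1] at this
      have hx' : x ∈ {x ∈ U | ρ x < 0} := hρ.inter_eq ▸ (⟨hx, hxU⟩ : x ∈ D ∩ U)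
      have := hGf (φ x) hxV.2 (by simpa [u, φ.left_inv hxV.1] using hx'.2)
      rw [hgV hxV]
      simpa [φ.left_inv hxV.1] using this
    · exact if_neg hxV
  refine ⟨V', hV', ⟨hps, haV⟩, g, ?_, hgD⟩
  rintro x (hx | hx)
  · exact ((hf.mdifferentiableAt (hD.mem_nhds hx)).congr_of_eventuallyEq
      (hgD.eventuallyEq_of_mem (hD.mem_nhds hx))).mdifferentiableWithinAt
  · exact ((hGV.mdifferentiableAt (hV'.mem_nhds hx)).congr_of_eventuallyEq
      (hgV.eventuallyEq_of_mem (hV'.mem_nhds hx))).mdifferentiableWithinAt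

end Manifolds

theorem nontrivial_ellTwo : Nontrivial EllTwo := by
  refine ⟨lp.single 2 0 1, 0, fun h => ?_⟩
  have := congrArg (fun x : EllTwo => (x : ℕ → ℂ) 0) h
  simp at this

end HartogsHilbert

theorem mainTheorem5
    {X : Type*} [TopologicalSpace X] [T2Space X] [SecondCountableTopology X]
    [ChartedSpace HartogsHilbert.EllTwo X] [IsManifold 𝓘(ℂ, HartogsHilbert.EllTwo) ω X]
    {Y : Type*} [TopologicalSpace Y] [T2Space Y] [SecondCountableTopology Y]
    [ChartedSpace HartogsHilbert.EllTwo Y] [IsManifold 𝓘(ℂ, HartogsHilbert.EllTwo) ω Y]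
    (q : ℕ) (hY : HartogsHilbert.IsHartogs HartogsHilbert.EllTwo q Y)
    (D : Set X) (hDopen : IsOpen D) (hDconn : IsConnected D)
    (p : X) (hp : HartogsHilbert.IsPseudoconcaveAt HartogsHilbert.EllTwo q D p)
    (f : X → Y)
    (hf : MDifferentiableOn 𝓘(ℂ, HartogsHilbert.EllTwo) 𝓘(ℂ, HartogsHilbert.EllTwo) f D) :
    ∃ V : Set X, IsOpen V ∧ p ∈ V ∧ ∃ g : X → Y,
      MDifferentiableOn 𝓘(ℂ, HartogsHilbert.EllTwo) 𝓘(ℂ, HartogsHilbert.EllTwo) g (D ∪ V) ∧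
      EqOn g f D := by
  have := HartogsHilbert.nontrivial_ellTwo
  exact HartogsHilbert.exists_extension_of_isPseudoconcaveAt hY hDopen hp hf
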